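/- A (left) skew brace is a triple $(A,+,\circ)$ in which $(A,+)$ and $(A,\circ)$ are groups and $a\circ(b+c)=a\circ b-a+a\circ c$ for all $a,b,c\in A$. Then $(A,\circ)$ acts on $(A,+)$ by automorphisms via $\lambda_a(x)=-a+a\circ x$. For finite $A$, the $\lambda$-graph $\Lambda(A)$ has as vertices the $\lambda$-orbits of size greater than $1$, two different orbits being adjacent when their sizes are not coprime. For an abelian group $G$ of odd order $d$ and an integer $i\ge 1$ define the following skew braces, where $k,k_1,k_2\in\mathbb Z/2\mathbb Z$, and where in a component in $\mathbb Z/2^i\mathbb Z$ the product $k_1k_2$ is read as the integer $0$ or $1$. $D_{2d}(G)$, on $G\times\mathbb Z/2\mathbb Z$: $$(g_1,k_1)+(g_2,k_2)=(g_1+(-1)^{k_1}g_2,\;k_1+k_2),\qquad (g_1,k_1)\circ(g_2,k_2)=((-1)^{k_2}g_1+(-1)^{k_1}g_2,\;k_1+k_2).$$ $J_{2^{i+1}d}(G)$, on $\mathbb Z/2^i\mathbb Z\times G\times\mathbb Z/2\mathbb Z$: $$(a_1,g_1,k_1)+(a_2,g_2,k_2)=(a_1+(-1)^{k_1}a_2,\;g_1+(-1)^{k_1}g_2,\;k_1+k_2),$$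 $$(a_1,g_1,k_1)\circ(a_2,g_2,k_2)=((-1)^{k_2}a_1+(-1)^{k_1}a_2-k_1k_2,\;(-1)^{k_2}g_1+(-1)^{k_1}g_2,\;k_1+k_2).$$ $H_{2^{i+1}d}(G)$, on $\mathbb Z/2^i\mathbb Z\times G\times\mathbb Z/2\mathbb Z$: $$(a_1,g_1,k_1)+(a_2,g_2,k_2)=(a_1+(-1)^{k_1}a_2+2^{i-1}k_1k_2,\;g_1+(-1)^{k_1}g_2,\;k_1+k_2),$$ $$(a_1,g_1,k_1)\circ(a_2,g_2,k_2)=((-1)^{k_2}a_1+(-1)^{k_1}a_2-k_1k_2+2^{i-1}k_1k_2,\;(-1)^{k_2}g_1+(-1)^{k_1}g_2,\;k_1+k_2).$$ $K_{8d}(G)$, on $\mathbb Z/2\mathbb Z\times\mathbb Z/2\mathbb Z\times G\times\mathbb Z/2\mathbb Z$: $$(a_1,b_1,g_1,k_1)+(a_2,b_2,g_2,k_2)=(a_1+a_2,\;b_1+b_2+k_1k_2,\;g_1+(-1)^{k_1}g_2,\;k_1+k_2),$$ $$(a_1,b_1,g_1,k_1)\circ(a_2,b_2,g_2,k_2)=(a_1+a_2+k_2b_1,\;b_1+b_2,\;(-1)^{k_2}g_1+(-1)^{k_1}g_2,\;k_1+k_2).$$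 **Theorem.** Let $m\ge 0$ and let $d\ge 1$ be odd. The following is a complete list, without repetitions up to isomorphism, of the skew braces of size $2^md$ whose $\lambda$-graph has exactly one vertex, where $G$ runs over the abelian groups of order $d$ up to isomorphism: - $m=0$: none; - $m=1$: $D_{2d}(G)$ if $d>1$, and none if $d=1$; - $m=2$: $J_{4d}(G)$ and $H_{4d}(G)$; - $m=3$: $K_{8d}(G)$, $J_{8d}(G)$ and $H_{8d}(G)$; - $m\ge 4$: $J_{2^md}(G)$ and $H_{2^md}(G)$. That is, every listed skew brace has size $2^md$ and a one-vertex $\lambda$-graph; every skew brace of size $2^md$ with a one-vertex $\lambda$-graph is isomorphic to a listed one; members of the same family are isomorphic if and only if the groups $G$ are; and members of different families of the same size are not isomorphic. Consequently, if $\operatorname{a}(d)$ is the number of isomorphism classes of abelian groups of order $d$, the number of isomorphism classes is $0$ for $m=0$; $\operatorname{a}(d)$ for $m=1$ and $d>1$; $0$ for $m=1$ and $d=1$; $2\operatorname{a}(d)$ for $m=2$; $3\operatorname{a}(d)$ for $m=3$; and $2\operatorname{a}(d)$ for $m\ge 4$. -/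

import Mathlib

universe u

/-- A (left) skew brace `(A, +, ∘)`: two group structures on `A`, neither assumed commutative, with
`a ∘ (b + c) = a ∘ b - a + a ∘ c`.  The operation `∘` is written `*`. -/
class SkewBrace (A : Type u) extends AddGroup A, Group A where
  skew_distrib : ∀ a b c : A, a * (b + c) = a * b - a + a * c

/-- An isomorphism of skew braces: a bijection preserving both `+` and `∘` (written `*`). -/
abbrev SkewBraceIso (A B : Type u) [SkewBrace A] [SkewBrace B] : Type u := A ≃+* B

namespace SkewBrace

theorem mul_zero_eq {A : Type u} [SkewBrace A] (a : A) : a * 0 = a := by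
  have h := skew_distrib a 0 0
  rw [add_zero] at h
  have h2 : a * 0 + 0 = a * 0 + (-a + a * 0) := by
    rw [add_zero, ← add_assoc, ← sub_eq_add_neg]; exact h
  have h3 := add_left_cancel h2
  exact (neg_add_eq_zero.mp h3.symm).symm

theorem one_eq_zero {A : Type u} [SkewBrace A] : (1 : A) = 0 := by
  simpa using (mul_zero_eq (1 : A)).symm

/-- The action `λ` of the group `(A, ∘)` on the group `(A, +)` by automorphisms,
`λ_a(x) = -a + a ∘ x`, as a homomorphism into the monoid of endomorphisms of `(A, +)`
(its image consists of automorphisms because `(A, ∘)` is a group). -/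
def lam (A : Type u) [SkewBrace A] : A →* AddMonoid.End A where
  toFun a :=
    { toFun := fun x => -a + a * x
      map_zero' := by rw [mul_zero_eq]; simp
      map_add' := fun x y => by
        rw [skew_distrib, sub_eq_add_neg]; simp only [add_assoc] }
  map_one' := by
    ext x
    change -1 + 1 * x = x
    rw [one_mul, one_eq_zero, neg_zero, zero_add]
  map_mul' a b := by
    ext x
    change -(a * b) + a * b * x = -a + a * (-b + b * x)
    have h0 : a * (-b) = a - a * b + a := by
      have h := skew_distrib a b (-b)
      rw [add_neg_cancel, mul_zero_eq] at h
      have : a * (-b) = -(a * b - a) + a := by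
        rw [eq_neg_add_iff_add_eq]; exact h.symm
      rw [this, neg_sub]
    rw [skew_distrib, h0]
    simp only [sub_eq_add_neg, add_assoc, neg_add_cancel_left, add_neg_cancel_left, mul_assoc]

end SkewBrace

/-! ### The common divisor graph -/

section CommonDivisorGraph

variable {G H : Type u} [Group G] [AddGroup H]

/-- The orbit of `x` under an action `α` of `G` on the group `H` by automorphisms. -/
def actionOrbit (α : G →* AddMonoid.End H) (x : H) : Set H := Set.range fun g => α g x

/-- The non-trivial orbits of `α` (those with more than one element), as a type. -/
def NontrivialOrbit (α : G →* AddMonoid.End H) : Type u :=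
  {L : Set H // (∃ x, L = actionOrbit α x) ∧ 1 < L.ncard}

/-- The common divisor graph: its vertices are the non-trivial orbits, and two different vertices
are adjacent when their sizes are not coprime. -/
def commonDivisorGraph (α : G →* AddMonoid.End H) : SimpleGraph (NontrivialOrbit α) where
  Adj L M := L ≠ M ∧ Nat.gcd L.1.ncard M.1.ncard ≠ 1
  symm := ⟨fun L M h => ⟨h.1.symm, by rw [Nat.gcd_comm]; exact h.2⟩⟩
  loopless := ⟨fun _ h => h.1 rfl⟩

end CommonDivisorGraph

/-- The `λ`-graph of a skew brace. -/
def lambdaGraph (A : Type u) [SkewBrace A] : SimpleGraph (NontrivialOrbit (SkewBrace.lam A)) :=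
  commonDivisorGraph (SkewBrace.lam A)

/-- The graph has exactly one vertex. -/
def SimpleGraph.HasExactlyOneVertex {V : Type u} (_Γ : SimpleGraph V) : Prop :=
  Nat.card V = 1

/-! ### The four families -/

/-- `(-1)^k` for `k ∈ ℤ/2ℤ`. -/
def zsgn (k : ZMod 2) : ℤ := (-1) ^ k.val

theorem zsgn_zero : zsgn 0 = 1 := rfl

theorem zsgn_one : zsgn 1 = -1 := rfl

theorem zmod2_cases (k : ZMod 2) : k = 0 ∨ k = 1 := by
  revert k; decide

theorem zmod2_one_add_one : (1 : ZMod 2) + 1 = 0 := rfl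

theorem zmod2_val_one : (1 : ZMod 2).val = 1 := rfl

/-- The underlying set `G × ℤ/2ℤ` of `D_{2d}(G)`, where `d = |G|`. -/
@[ext] structure DBrace (G : Type u) : Type u where
  g : G
  k : ZMod 2

/-- The underlying set `ℤ/2^iℤ × G × ℤ/2ℤ` of `J_{2^(i+1)d}(G)`, where `d = |G|`. -/
@[ext] structure JBrace (i : ℕ) (G : Type u) : Type u where
  a : ZMod (2 ^ i)
  g : G
  k : ZMod 2

/-- The underlying set `ℤ/2^iℤ × G × ℤ/2ℤ` of `H_{2^(i+1)d}(G)`, where `d = |G|`. -/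
@[ext] structure HBrace (i : ℕ) (G : Type u) : Type u where
  a : ZMod (2 ^ i)
  g : G
  k : ZMod 2

/-- The underlying set `ℤ/2ℤ × ℤ/2ℤ × G × ℤ/2ℤ` of `K_{8d}(G)`, where `d = |G|`. -/
@[ext] structure KBrace (G : Type u) : Type u where
  a : ZMod 2
  b : ZMod 2
  g : G
  k : ZMod 2

section Families

variable {G : Type u} [AddCommGroup G]

namespace DBrace

instance : Add (DBrace G) := ⟨fun x y => ⟨x.g + zsgn x.k • y.g, x.k + y.k⟩⟩

instance : Mul (DBrace G) := ⟨fun x y => ⟨zsgn y.k • x.g + zsgn x.k • y.g, x.k + y.k⟩⟩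

instance : Zero (DBrace G) := ⟨⟨0, 0⟩⟩

instance : One (DBrace G) := ⟨⟨0, 0⟩⟩

instance : Neg (DBrace G) := ⟨fun x => ⟨-(zsgn x.k • x.g), x.k⟩⟩

instance : Inv (DBrace G) := ⟨fun x => ⟨-x.g, x.k⟩⟩

theorem add_def (x y : DBrace G) : x + y = ⟨x.g + zsgn x.k • y.g, x.k + y.k⟩ := rfl

theorem mul_def (x y : DBrace G) : x * y = ⟨zsgn y.k • x.g + zsgn x.k • y.g, x.k + y.k⟩ := rfl

theorem zero_def : (0 : DBrace G) = ⟨0, 0⟩ := rfl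

theorem one_def : (1 : DBrace G) = ⟨0, 0⟩ := rfl

theorem neg_def (x : DBrace G) : -x = ⟨-(zsgn x.k • x.g), x.k⟩ := rfl

theorem inv_def (x : DBrace G) : x⁻¹ = ⟨-x.g, x.k⟩ := rfl

instance : AddGroup (DBrace G) := AddGroup.ofLeftAxioms
  (by
    rintro ⟨g, k⟩ ⟨g', k'⟩ ⟨g'', k''⟩
    rcases zmod2_cases k with rfl | rfl <;> rcases zmod2_cases k' with rfl | rfl <;>
      simp [add_def, zsgn_zero, zsgn_one, zmod2_one_add_one, ← add_assoc])
  (by rintro ⟨g, k⟩; simp [add_def, zero_def, zsgn_zero])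
  (by
    rintro ⟨g, k⟩
    rcases zmod2_cases k with rfl | rfl <;>
      simp [add_def, neg_def, zero_def, zsgn_zero, zsgn_one, zmod2_one_add_one])

instance : Group (DBrace G) := Group.ofLeftAxioms
  (by
    rintro ⟨g, k⟩ ⟨g', k'⟩ ⟨g'', k''⟩
    rcases zmod2_cases k with rfl | rfl <;> rcases zmod2_cases k' with rfl | rfl <;>
      rcases zmod2_cases k'' with rfl | rfl <;>
      simp [mul_def, zsgn_zero, zsgn_one, zmod2_one_add_one] <;> abel)
  (by rintro ⟨g, k⟩; simp [mul_def, one_def, zsgn_zero])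
  (by
    rintro ⟨g, k⟩
    rcases zmod2_cases k with rfl | rfl <;>
      simp [mul_def, inv_def, one_def, zsgn_zero, zsgn_one, zmod2_one_add_one])

/-- The skew brace `D_{2d}(G)`. -/
instance : SkewBrace (DBrace G) where
  __ := (inferInstance : AddGroup (DBrace G))
  __ := (inferInstance : Group (DBrace G))
  skew_distrib := by
    rintro ⟨g, k⟩ ⟨g', k'⟩ ⟨g'', k''⟩
    rcases zmod2_cases k with rfl | rfl <;> rcases zmod2_cases k' with rfl | rfl <;>
      rcases zmod2_cases k'' with rfl | rfl <;>
      simp [sub_eq_add_neg, neg_def, mul_def, add_def, zsgn_zero, zsgn_one,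
        zmod2_one_add_one] <;> abel

end DBrace

namespace JBrace

variable {i : ℕ}

instance : Add (JBrace i G) :=
  ⟨fun x y => ⟨x.a + zsgn x.k • y.a, x.g + zsgn x.k • y.g, x.k + y.k⟩⟩

/-- The term `(x.k * y.k).val`, which is `0` or `1`, is `(1 - (-1)^(k₁k₂)) / 2`. -/
instance : Mul (JBrace i G) :=
  ⟨fun x y => ⟨zsgn y.k • x.a + zsgn x.k • y.a - ((x.k * y.k).val : ZMod (2 ^ i)),
    zsgn y.k • x.g + zsgn x.k • y.g, x.k + y.k⟩⟩

instance : Zero (JBrace i G) := ⟨⟨0, 0, 0⟩⟩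

instance : One (JBrace i G) := ⟨⟨0, 0, 0⟩⟩

instance : Neg (JBrace i G) := ⟨fun x => ⟨-(zsgn x.k • x.a), -(zsgn x.k • x.g), x.k⟩⟩

instance : Inv (JBrace i G) := ⟨fun x => ⟨-x.a - (x.k.val : ZMod (2 ^ i)), -x.g, x.k⟩⟩

theorem add_def (x y : JBrace i G) :
    x + y = ⟨x.a + zsgn x.k • y.a, x.g + zsgn x.k • y.g, x.k + y.k⟩ := rfl

theorem mul_def (x y : JBrace i G) :
    x * y = ⟨zsgn y.k • x.a + zsgn x.k • y.a - ((x.k * y.k).val : ZMod (2 ^ i)),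
      zsgn y.k • x.g + zsgn x.k • y.g, x.k + y.k⟩ := rfl

theorem zero_def : (0 : JBrace i G) = ⟨0, 0, 0⟩ := rfl

theorem one_def : (1 : JBrace i G) = ⟨0, 0, 0⟩ := rfl

theorem neg_def (x : JBrace i G) :
    -x = ⟨-(zsgn x.k • x.a), -(zsgn x.k • x.g), x.k⟩ := rfl

theorem inv_def (x : JBrace i G) :
    x⁻¹ = ⟨-x.a - (x.k.val : ZMod (2 ^ i)), -x.g, x.k⟩ := rfl

instance : AddGroup (JBrace i G) := AddGroup.ofLeftAxioms
  (by
    rintro ⟨a, g, k⟩ ⟨a', g', k'⟩ ⟨a'', g'', k''⟩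
    rcases zmod2_cases k with rfl | rfl <;> rcases zmod2_cases k' with rfl | rfl <;>
      simp [add_def, zsgn_zero, zsgn_one, zmod2_one_add_one, ← add_assoc])
  (by rintro ⟨a, g, k⟩; simp [add_def, zero_def, zsgn_zero])
  (by
    rintro ⟨a, g, k⟩
    rcases zmod2_cases k with rfl | rfl <;>
      simp [add_def, neg_def, zero_def, zsgn_zero, zsgn_one, zmod2_one_add_one])

instance : Group (JBrace i G) := Group.ofLeftAxioms
  (by
    rintro ⟨a, g, k⟩ ⟨a', g', k'⟩ ⟨a'', g'', k''⟩
    rcases zmod2_cases k with rfl | rfl <;> rcases zmod2_cases k' with rfl | rfl <;>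
      rcases zmod2_cases k'' with rfl | rfl <;>
      simp [mul_def, zsgn_zero, zsgn_one, zmod2_one_add_one, zmod2_val_one] <;>
      constructor <;> abel)
  (by rintro ⟨a, g, k⟩; simp [mul_def, one_def, zsgn_zero])
  (by
    rintro ⟨a, g, k⟩
    rcases zmod2_cases k with rfl | rfl <;>
      simp [mul_def, inv_def, one_def, zsgn_zero, zsgn_one, zmod2_one_add_one, zmod2_val_one])

/-- The skew brace `J_{2^(i+1)d}(G)`. -/
instance : SkewBrace (JBrace i G) where
  __ := (inferInstance : AddGroup (JBrace i G))
  __ := (inferInstance : Group (JBrace i G))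
  skew_distrib := by
    rintro ⟨a, g, k⟩ ⟨a', g', k'⟩ ⟨a'', g'', k''⟩
    rcases zmod2_cases k with rfl | rfl <;> rcases zmod2_cases k' with rfl | rfl <;>
      rcases zmod2_cases k'' with rfl | rfl <;>
      simp [sub_eq_add_neg, neg_def, mul_def, add_def, zsgn_zero, zsgn_one,
        zmod2_one_add_one, zmod2_val_one] <;> constructor <;> abel

end JBrace

namespace HBrace

variable {i : ℕ}

/-- The element `2^(i-1) k₁ k₂` of `ℤ/2^iℤ` (for `i ≥ 1`). -/
def cocycle (i : ℕ) (k₁ k₂ : ZMod 2) : ZMod (2 ^ i) := 2 ^ (i - 1) * ((k₁ * k₂).val : ZMod (2 ^ i))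

instance : Add (HBrace i G) :=
  ⟨fun x y => ⟨x.a + zsgn x.k • y.a + cocycle i x.k y.k, x.g + zsgn x.k • y.g, x.k + y.k⟩⟩

/-- The term `(x.k * y.k).val`, which is `0` or `1`, is `(1 - (-1)^(k₁k₂)) / 2`. -/
instance : Mul (HBrace i G) :=
  ⟨fun x y => ⟨zsgn y.k • x.a + zsgn x.k • y.a - ((x.k * y.k).val : ZMod (2 ^ i))
      + cocycle i x.k y.k,
    zsgn y.k • x.g + zsgn x.k • y.g, x.k + y.k⟩⟩

instance : Zero (HBrace i G) := ⟨⟨0, 0, 0⟩⟩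

instance : One (HBrace i G) := ⟨⟨0, 0, 0⟩⟩

instance : Neg (HBrace i G) :=
  ⟨fun x => ⟨-(zsgn x.k • x.a) + cocycle i x.k x.k, -(zsgn x.k • x.g), x.k⟩⟩

instance : Inv (HBrace i G) :=
  ⟨fun x => ⟨-x.a - (x.k.val : ZMod (2 ^ i)) + cocycle i x.k x.k, -x.g, x.k⟩⟩

theorem add_def (x y : HBrace i G) :
    x + y = ⟨x.a + zsgn x.k • y.a + cocycle i x.k y.k, x.g + zsgn x.k • y.g, x.k + y.k⟩ := rfl

theorem mul_def (x y : HBrace i G) :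
    x * y = ⟨zsgn y.k • x.a + zsgn x.k • y.a - ((x.k * y.k).val : ZMod (2 ^ i))
      + cocycle i x.k y.k,
      zsgn y.k • x.g + zsgn x.k • y.g, x.k + y.k⟩ := rfl

theorem zero_def : (0 : HBrace i G) = ⟨0, 0, 0⟩ := rfl

theorem one_def : (1 : HBrace i G) = ⟨0, 0, 0⟩ := rfl

theorem neg_def (x : HBrace i G) :
    -x = ⟨-(zsgn x.k • x.a) + cocycle i x.k x.k, -(zsgn x.k • x.g), x.k⟩ := rfl

theorem inv_def (x : HBrace i G) :
    x⁻¹ = ⟨-x.a - (x.k.val : ZMod (2 ^ i)) + cocycle i x.k x.k, -x.g, x.k⟩ := rfl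

theorem cocycle_zero_left (k : ZMod 2) : cocycle i 0 k = 0 := by simp [cocycle]

theorem cocycle_zero_right (k : ZMod 2) : cocycle i k 0 = 0 := by simp [cocycle]

theorem neg_cocycle (k₁ k₂ : ZMod 2) : -cocycle i k₁ k₂ = cocycle i k₁ k₂ := by
  have h : (2 : ZMod (2 ^ i)) ^ (i - 1) + 2 ^ (i - 1) = 0 := by
    rcases i with _ | i
    · exact Subsingleton.elim (α := ZMod 1) _ _
    · rw [Nat.add_sub_cancel, ← two_mul, ← pow_succ']
      exact_mod_cast ZMod.natCast_self (2 ^ (i + 1))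
  rw [neg_eq_iff_add_eq_zero, cocycle, ← add_mul, h, zero_mul]

theorem cocycle_add_self (k₁ k₂ : ZMod 2) : cocycle i k₁ k₂ + cocycle i k₁ k₂ = 0 := by
  rw [← neg_eq_iff_add_eq_zero, neg_cocycle]

instance : AddGroup (HBrace i G) := AddGroup.ofLeftAxioms
  (by
    rintro ⟨a, g, k⟩ ⟨a', g', k'⟩ ⟨a'', g'', k''⟩
    rcases zmod2_cases k with rfl | rfl <;> rcases zmod2_cases k' with rfl | rfl <;>
      rcases zmod2_cases k'' with rfl | rfl <;>
      simp [add_def, zsgn_zero, zsgn_one, zmod2_one_add_one, cocycle_zero_left,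
        cocycle_zero_right, neg_cocycle] <;>
      constructor <;> abel)
  (by rintro ⟨a, g, k⟩; simp [add_def, zero_def, zsgn_zero, cocycle_zero_left])
  (by
    rintro ⟨a, g, k⟩
    rcases zmod2_cases k with rfl | rfl <;>
      simp [add_def, neg_def, zero_def, zsgn_zero, zsgn_one, zmod2_one_add_one,
        cocycle_zero_left]
    exact cocycle_add_self 1 1)

instance : Group (HBrace i G) := Group.ofLeftAxioms
  (by
    rintro ⟨a, g, k⟩ ⟨a', g', k'⟩ ⟨a'', g'', k''⟩
    rcases zmod2_cases k with rfl | rfl <;> rcases zmod2_cases k' with rfl | rfl <;>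
      rcases zmod2_cases k'' with rfl | rfl <;>
      simp [mul_def, zsgn_zero, zsgn_one, zmod2_one_add_one, zmod2_val_one, cocycle_zero_left,
        cocycle_zero_right, neg_cocycle] <;>
      constructor <;> abel1)
  (by rintro ⟨a, g, k⟩; simp [mul_def, one_def, zsgn_zero, cocycle_zero_left])
  (by
    rintro ⟨a, g, k⟩
    rcases zmod2_cases k with rfl | rfl <;>
      simp [mul_def, inv_def, one_def, zsgn_zero, zsgn_one, zmod2_one_add_one, zmod2_val_one,
        cocycle_zero_left, neg_cocycle]
    linear_combination cocycle_add_self (i := i) 1 1)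

/-- The skew brace `H_{2^(i+1)d}(G)`. -/
instance : SkewBrace (HBrace i G) where
  __ := (inferInstance : AddGroup (HBrace i G))
  __ := (inferInstance : Group (HBrace i G))
  skew_distrib := by
    rintro ⟨a, g, k⟩ ⟨a', g', k'⟩ ⟨a'', g'', k''⟩
    rcases zmod2_cases k with rfl | rfl <;> rcases zmod2_cases k' with rfl | rfl <;>
      rcases zmod2_cases k'' with rfl | rfl <;>
      simp [sub_eq_add_neg, neg_def, mul_def, add_def, zsgn_zero, zsgn_one,
        zmod2_one_add_one, zmod2_val_one, cocycle_zero_left, cocycle_zero_right, neg_cocycle] <;>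
      constructor <;> first
        | abel1
        | linear_combination cocycle_add_self (i := i) 1 1
        | linear_combination -cocycle_add_self (i := i) 1 1

end HBrace

namespace KBrace

instance : Add (KBrace G) :=
  ⟨fun x y => ⟨x.a + y.a, x.b + y.b + x.k * y.k, x.g + zsgn x.k • y.g, x.k + y.k⟩⟩

instance : Mul (KBrace G) :=
  ⟨fun x y => ⟨x.a + y.a + y.k * x.b, x.b + y.b, zsgn y.k • x.g + zsgn x.k • y.g, x.k + y.k⟩⟩

instance : Zero (KBrace G) := ⟨⟨0, 0, 0, 0⟩⟩

instance : One (KBrace G) := ⟨⟨0, 0, 0, 0⟩⟩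

instance : Neg (KBrace G) := ⟨fun x => ⟨x.a, x.b + x.k, -(zsgn x.k • x.g), x.k⟩⟩

instance : Inv (KBrace G) := ⟨fun x => ⟨x.a + x.k * x.b, x.b, -x.g, x.k⟩⟩

theorem add_def (x y : KBrace G) :
    x + y = ⟨x.a + y.a, x.b + y.b + x.k * y.k, x.g + zsgn x.k • y.g, x.k + y.k⟩ := rfl

theorem mul_def (x y : KBrace G) :
    x * y = ⟨x.a + y.a + y.k * x.b, x.b + y.b, zsgn y.k • x.g + zsgn x.k • y.g, x.k + y.k⟩ := rfl

theorem zero_def : (0 : KBrace G) = ⟨0, 0, 0, 0⟩ := rfl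

theorem one_def : (1 : KBrace G) = ⟨0, 0, 0, 0⟩ := rfl

theorem neg_def (x : KBrace G) : -x = ⟨x.a, x.b + x.k, -(zsgn x.k • x.g), x.k⟩ := rfl

theorem inv_def (x : KBrace G) : x⁻¹ = ⟨x.a + x.k * x.b, x.b, -x.g, x.k⟩ := rfl

instance : AddGroup (KBrace G) := AddGroup.ofLeftAxioms
  (by
    rintro ⟨a, b, g, k⟩ ⟨a', b', g', k'⟩ ⟨a'', b'', g'', k''⟩
    rw [add_def, add_def, add_def, add_def, KBrace.ext_iff]
    refine ⟨add_assoc _ _ _, by ring, ?_, add_assoc _ _ _⟩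
    rcases zmod2_cases k with rfl | rfl <;> rcases zmod2_cases k' with rfl | rfl <;>
      simp [zsgn_zero, zsgn_one, zmod2_one_add_one] <;> abel)
  (by rintro ⟨a, b, g, k⟩; simp [add_def, zero_def, zsgn_zero])
  (by
    rintro ⟨a, b, g, k⟩
    rw [add_def, KBrace.ext_iff]
    simp only [neg_def, zero_def]
    refine ⟨?_, ?_, ?_, ?_⟩
    · revert a; decide
    · revert b k; decide
    · rcases zmod2_cases k with rfl | rfl <;> simp [zsgn_zero, zsgn_one]
    · revert k; decide)

instance : Group (KBrace G) := Group.ofLeftAxioms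
  (by
    rintro ⟨a, b, g, k⟩ ⟨a', b', g', k'⟩ ⟨a'', b'', g'', k''⟩
    rw [mul_def, mul_def, mul_def, mul_def, KBrace.ext_iff]
    refine ⟨by ring, add_assoc _ _ _, ?_, add_assoc _ _ _⟩
    rcases zmod2_cases k with rfl | rfl <;> rcases zmod2_cases k' with rfl | rfl <;>
      rcases zmod2_cases k'' with rfl | rfl <;>
      simp [zsgn_zero, zsgn_one, zmod2_one_add_one] <;> abel)
  (by rintro ⟨a, b, g, k⟩; simp [mul_def, one_def, zsgn_zero])
  (by
    rintro ⟨a, b, g, k⟩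
    rw [mul_def, KBrace.ext_iff]
    simp only [inv_def, one_def]
    refine ⟨?_, ?_, ?_, ?_⟩
    · revert a b k; decide
    · revert b; decide
    · rcases zmod2_cases k with rfl | rfl <;> simp [zsgn_zero, zsgn_one]
    · revert k; decide)

/-- The skew brace `K_{8d}(G)`. -/
instance : SkewBrace (KBrace G) where
  __ := (inferInstance : AddGroup (KBrace G))
  __ := (inferInstance : Group (KBrace G))
  skew_distrib := by
    rintro ⟨a, b, g, k⟩ ⟨a', b', g', k'⟩ ⟨a'', b'', g'', k''⟩
    rw [sub_eq_add_neg, KBrace.ext_iff]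
    simp only [neg_def, mul_def, add_def]
    refine ⟨?_, ?_, ?_, ?_⟩
    · revert a a' a'' b k' k''; decide
    · revert b b' b'' k k' k''; decide
    · rcases zmod2_cases k with rfl | rfl <;> rcases zmod2_cases k' with rfl | rfl <;>
        rcases zmod2_cases k'' with rfl | rfl <;>
        simp [zsgn_zero, zsgn_one, zmod2_one_add_one] <;> abel
    · revert k k' k''; decide

end KBrace

end Families

/-! ### Numbers of isomorphism classes -/

/-- An abelian group of order `d`. -/
structure AbelianGroupOfOrder (d : ℕ) : Type (u + 1) where
  carrier : Type u
  [group : AddCommGroup carrier]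
  card_eq : Nat.card carrier = d

attribute [instance] AbelianGroupOfOrder.group

/-- Isomorphism of abelian groups of order `d`. -/
def AbelianGroupOfOrder.isoSetoid (d : ℕ) : Setoid (AbelianGroupOfOrder.{u} d) where
  r G G' := Nonempty (G.carrier ≃+ G'.carrier)
  iseqv := ⟨fun _ => ⟨AddEquiv.refl _⟩, fun ⟨e⟩ => ⟨e.symm⟩, fun ⟨e⟩ ⟨f⟩ => ⟨e.trans f⟩⟩

/-- The number `a(d)` of isomorphism classes of abelian groups of order `d`. -/
noncomputable def numAbelianGroups (d : ℕ) : ℕ :=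
  Nat.card (Quotient (AbelianGroupOfOrder.isoSetoid.{u} d))

/-- A skew brace of size `n` whose `λ`-graph has exactly one vertex. -/
structure OneVertexSkewBrace (n : ℕ) : Type (u + 1) where
  carrier : Type u
  [skewBrace : SkewBrace carrier]
  [finite : Finite carrier]
  card_eq : Nat.card carrier = n
  oneVertex : (lambdaGraph carrier).HasExactlyOneVertex

attribute [instance] OneVertexSkewBrace.skewBrace OneVertexSkewBrace.finite

/-- Isomorphism of skew braces of size `n` with one-vertex `λ`-graph. -/
def OneVertexSkewBrace.isoSetoid (n : ℕ) : Setoid (OneVertexSkewBrace.{u} n) where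
  r A B := Nonempty (SkewBraceIso A.carrier B.carrier)
  iseqv := ⟨fun _ => ⟨RingEquiv.refl _⟩, fun ⟨e⟩ => ⟨e.symm⟩, fun ⟨e⟩ ⟨f⟩ => ⟨e.trans f⟩⟩

/-- The number of isomorphism classes of skew braces of size `n` whose `λ`-graph has exactly one
vertex. -/
noncomputable def numOneVertexSkewBraces (n : ℕ) : ℕ :=
  Nat.card (Quotient (OneVertexSkewBrace.isoSetoid.{u} n))

/-! Let `F` be the additive subgroup of points fixed by `λ`. With one vertex, the complement of `F`
is a single orbit. If `F` has index `q`, this orbit has `|F|(q - 1)` elements and its length divides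
`|A| = |F|q`; so `q - 1` divides `q` and `q = 2` (`index_lamFixed`). Hence `A = F ∪ (F + t)`.
Comparing `t` with its images `y + t` under `λ` shows that `F` is abelian and that `t` inverts it.
Both operations are then determined by `z = t + t`, by `c = λ_t(t) - t` and by the endomorphism
`φ(x) = λ_x(t) - t` (`exists_isDihedralExtension`). Transitivity on `F + t` says `F = φF ∪ (c +
φF)`, and associativity of `∘` forces `φ² = -2φ` and `φ(z - c) = 2c`, while `2z = 0`. Replacing `t`
by `y + t` changes only `c`, by `-φ(y)`.

It remains to solve these equations. Write `F = P × G` with `|P| = 2^i` and `|G| = d` odd; by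
coprimality `φ` splits. On `G` it must be `-2`, `z` vanishes, and `c` can be shifted to `0`
(`eq_negDouble_of_coveredBy_of_odd`). On `P`, if `φ(c) = -2c`, then `P` is cyclic, generated by `c`,
and `φ = -2`; the two choices of `z` with `2z = 0` give `J` and `H`, or `D` when `P` is trivial
(`zmultiples_eq_top_of_coveredBy`). Otherwise `φ(z) ≠ 0`, and `P` is a Klein group with basis `φ(z),
z`, which gives `K` (`exists_klein_addEquiv_of_coveredBy`).

Conversely, when `F` is nontrivial it is recovered from the skew brace as the set of fixed points,
and `φ` and `z` do not depend on the choice of `t`. So the triple `(F, φ, z)` is an invariant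
(`exists_addEquiv`): its odd part gives `G`, `z` separates `J` from `H`, and `φ` separates `K` from
both. -/

/-! ### Extensions of an abelian group by an inverting element: formulas, orbits and invariants. -/

/-- `A` is the union of `ι F` and `ι F + t`, where `ι F` is an abelian group inverted by `t`, the
action `λ` is trivial on `ι F`, and the operations of `A` are determined by `φ`, `c` and `z`. -/
structure IsDihedralExtension {F : Type*} [AddCommGroup F] {A : Type*} [SkewBrace A]
    (φ : F →+ F) (c z : F) (ι : F →+ A) (t : A) : Prop where
  inj : Function.Injective ι
  cover : ∀ a, (∃ x, a = ι x) ∨ ∃ x, a = ι x + t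
  notMem : ∀ x, ι x ≠ t
  add_conj : ∀ x, t + ι x = ι (-x) + t
  add_self : t + t = ι z
  mul_map : ∀ a x, a * ι x = a + ι x
  map_mul : ∀ x, ι x * t = ι (x + φ x) + t
  mul_self : t * t = ι (z - c)

/-- Every element of `F` lies in `φ F` or in `c + φ F`. -/
def CoveredBy {F : Type*} [AddCommGroup F] (φ : F →+ F) (c : F) : Prop :=
  ∀ y, ∃ x, y = φ x ∨ y = c + φ x

namespace IsDihedralExtension

variable {F : Type*} [AddCommGroup F] {A : Type*} [SkewBrace A]
  {φ : F →+ F} {c z : F} {ι : F →+ A} {t : A}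

section

variable (h : IsDihedralExtension φ c z ι t)
include h

theorem map_add_ne (x y : F) : ι x ≠ ι y + t := by
  intro e
  apply h.notMem (-y + x)
  rw [map_add, e, ← add_assoc, ← map_add, neg_add_cancel, map_zero, zero_add]

/-- The element `t` commutes with `t + t`, but it also inverts it. -/
theorem two_smul_add_self : z + z = 0 := by
  have h1 : ι (-z) + t = ι z + t := by
    rw [← h.add_conj, ← h.add_self, add_assoc]
  have h2 := h.inj (add_right_cancel h1)
  rw [← neg_eq_iff_add_eq_zero, h2]

theorem add_add_map (x y : F) : (ι x + t) + ι y = ι (x - y) + t := by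
  rw [add_assoc, h.add_conj, ← add_assoc, ← map_add, sub_eq_add_neg]

theorem add_add_add (x y : F) : (ι x + t) + (ι y + t) = ι (x - y + z) := by
  rw [← add_assoc, h.add_add_map, add_assoc, h.add_self, ← map_add]

theorem neg_map_add (x : F) : -(ι x + t) = ι (x + z) + t := by
  rw [neg_eq_iff_add_eq_zero, h.add_add_add]
  rw [show x - (x + z) + z = 0 by abel, map_zero]

theorem map_mul_map (x y : F) : ι x * ι y = ι (x + y) := by
  rw [h.mul_map, map_add]

theorem add_mul_map (x y : F) : (ι x + t) * ι y = ι (x - y) + t := by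
  rw [h.mul_map, h.add_add_map]

theorem map_add_eq_mul (y : F) : ι y + t = t * ι (-y) := by
  rw [h.mul_map, h.add_conj, neg_neg]

theorem map_mul_add (x y : F) : ι x * (ι y + t) = ι (x + φ x + y) + t := by
  rw [h.map_add_eq_mul, ← mul_assoc, h.map_mul, h.add_mul_map, sub_neg_eq_add]

theorem add_mul_add (x y : F) : (ι x + t) * (ι y + t) = ι (z - c + x + φ x - y) := by
  rw [h.map_add_eq_mul x, mul_assoc, h.map_mul_add, h.map_add_eq_mul, ← mul_assoc, h.mul_self,
    h.map_mul_map, map_neg]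
  congr 1
  abel_nf

/-- This is associativity of `∘` on the triple `x, t, t`. -/
theorem map_map (x : F) : φ (φ x) = -(φ x + φ x) := by
  have e := mul_assoc (ι x) t t
  have ht : t = ι 0 + t := by rw [map_zero, zero_add]
  rw [h.map_mul, h.mul_self, h.map_mul_map] at e
  rw [ht, ← add_assoc, ← ι.map_add, h.add_mul_add] at e
  have e := h.inj e
  rw [add_zero, φ.map_add] at e
  rw [eq_neg_iff_add_eq_zero]
  have : φ (φ x) + (φ x + φ x) = (z - c + (x + φ x) + (φ x + φ (φ x)) - 0) - (x + (z - c)) := by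
    abel
  rw [this, e, sub_self]

/-- This is associativity of `∘` on the triple `t, t, t`, simplified by `2z = 0`. -/
theorem map_sub_eq : φ (z - c) = c + c := by
  have e := mul_assoc t t t
  rw [h.mul_self, h.map_mul, h.mul_map, h.add_conj] at e
  have e := h.inj (add_right_cancel e)
  have hz := h.two_smul_add_self
  have : φ (z - c) = (z - c + φ (z - c)) - (z - c) := by abel
  rw [this, e]
  have : -(z - c) - (z - c) = c + c - (z + z) := by abel
  rw [this, hz, sub_zero]

theorem sumElim_bijective :
    Function.Bijective (Sum.elim (fun x => ι x) fun x => ι x + t : F ⊕ F → A) := by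
  constructor
  · rintro (x | x) (y | y) e <;> simp only [Sum.elim_inl, Sum.elim_inr] at e
    · rw [h.inj e]
    · exact (h.map_add_ne _ _ e).elim
    · exact (h.map_add_ne _ _ e.symm).elim
    · rw [h.inj (add_right_cancel e)]
  · intro a
    rcases h.cover a with ⟨x, rfl⟩ | ⟨x, rfl⟩
    · exact ⟨Sum.inl x, rfl⟩
    · exact ⟨Sum.inr x, rfl⟩

theorem nat_card : Nat.card A = 2 * Nat.card F := by
  rw [← Nat.card_congr (Equiv.ofBijective _ h.sumElim_bijective), two_mul]
  rcases finite_or_infinite F with hF | hF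
  · exact Nat.card_sum
  · simp

/-- Replacing `t` by `ι y + t` changes `c` by an element of the image of `φ`. -/
theorem shift (y : F) : IsDihedralExtension φ (c - φ y) z ι (ι y + t) where
  inj := h.inj
  cover a := by
    rcases h.cover a with ⟨x, rfl⟩ | ⟨x, rfl⟩
    · exact Or.inl ⟨x, rfl⟩
    · exact Or.inr ⟨x - y, by rw [← add_assoc, ← map_add, sub_add_cancel]⟩
  notMem x := h.map_add_ne x y
  add_conj x := by
    rw [h.add_add_map, ← add_assoc, ← map_add, neg_add_eq_sub]
  add_self := by rw [h.add_add_add, sub_self, zero_add]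
  mul_map := h.mul_map
  map_mul x := by rw [h.map_mul_add, ← add_assoc, ← map_add]
  mul_self := by
    rw [h.add_mul_add]
    congr 1
    abel

/-- Transport along an isomorphism onto `F`. -/
theorem comap {F' : Type*} [AddCommGroup F'] (e : F' ≃+ F) {φ' : F' →+ F'} {c' z' : F'}
    (hφ : ∀ x, e (φ' x) = φ (e x)) (hc : e c' = c) (hz : e z' = z) :
    IsDihedralExtension φ' c' z' (ι.comp e.toAddMonoidHom) t where
  inj := h.inj.comp e.injective
  cover a := by
    rcases h.cover a with ⟨x, rfl⟩ | ⟨x, rfl⟩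
    · exact Or.inl ⟨e.symm x, by simp⟩
    · exact Or.inr ⟨e.symm x, by simp⟩
  notMem x := h.notMem _
  add_conj x := by simpa using h.add_conj (e x)
  add_self := by simpa [hz] using h.add_self
  mul_map a x := by simpa using h.mul_map a (e x)
  map_mul x := by simpa [hφ] using h.map_mul (e x)
  mul_self := by simpa [hz, hc] using h.mul_self

/-- Skew braces that are extensions with the same data are isomorphic. -/
theorem nonempty_ringEquiv {B : Type*} [SkewBrace B] {κ : F →+ B} {s : B}
    (h' : IsDihedralExtension φ c z κ s) : Nonempty (A ≃+* B) := by
  let f : A ≃ B := (Equiv.ofBijective _ h.sumElim_bijective).symm.trans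
    (Equiv.ofBijective _ h'.sumElim_bijective)
  have f1 : ∀ x, f (ι x) = κ x := fun x => by
    have : (Equiv.ofBijective _ h.sumElim_bijective).symm (ι x) = Sum.inl x :=
      (Equiv.symm_apply_eq _).2 rfl
    simp [f, this]
  have f2 : ∀ x, f (ι x + t) = κ x + s := fun x => by
    have : (Equiv.ofBijective _ h.sumElim_bijective).symm (ι x + t) = Sum.inr x :=
      (Equiv.symm_apply_eq _).2 rfl
    simp [f, this]
  refine ⟨{ f with map_mul' := ?_, map_add' := ?_ }⟩
  · intro a b
    change f (a * b) = f a * f b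
    rcases h.cover a with ⟨x, rfl⟩ | ⟨x, rfl⟩ <;> rcases h.cover b with ⟨y, rfl⟩ | ⟨y, rfl⟩
    · rw [h.map_mul_map, f1, f1, f1, h'.map_mul_map]
    · rw [h.map_mul_add, f1, f2, f2, h'.map_mul_add]
    · rw [h.add_mul_map, f2, f1, f2, h'.add_mul_map]
    · rw [h.add_mul_add, f2, f2, f1, h'.add_mul_add]
  · intro a b
    change f (a + b) = f a + f b
    rcases h.cover a with ⟨x, rfl⟩ | ⟨x, rfl⟩ <;> rcases h.cover b with ⟨y, rfl⟩ | ⟨y, rfl⟩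
    · rw [← map_add, f1, f1, f1, map_add]
    · rw [← add_assoc, ← map_add, f1, f2, f2, map_add, add_assoc]
    · rw [h.add_add_map, f2, f1, f2, h'.add_add_map]
    · rw [h.add_add_add, f2, f2, f1, h'.add_add_add]

theorem lam_map (a : A) (x : F) : SkewBrace.lam A a (ι x) = ι x := by
  change -a + a * ι x = ι x
  rw [h.mul_map, neg_add_cancel_left]

theorem lam_map_add (x y : F) : SkewBrace.lam A (ι x) (ι y + t) = ι (φ x + y) + t := by
  change -ι x + ι x * (ι y + t) = _
  rw [h.map_mul_add, ← add_assoc, ← map_neg, ← map_add]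
  congr 2
  abel

theorem lam_add_add (x y : F) : SkewBrace.lam A (ι x + t) (ι y + t) = ι (c - φ x + y) + t := by
  change -(ι x + t) + (ι x + t) * (ι y + t) = _
  rw [h.add_mul_add, h.neg_map_add, h.add_add_map]
  congr 2
  abel

theorem actionOrbit_map (x : F) : actionOrbit (SkewBrace.lam A) (ι x) = {ι x} := by
  ext a
  simp only [actionOrbit, h.lam_map, Set.range_const]

/-- On the coset of `t`, the element `ι x` acts as translation by `φ x` and `ι x + t` as translation
by `c - φ x`. Thus `CoveredBy` is exactly transitivity on the coset. -/
theorem actionOrbit_map_add (hc : CoveredBy φ c) (y : F) :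
    actionOrbit (SkewBrace.lam A) (ι y + t) = Set.range fun x => ι x + t := by
  ext a
  constructor
  · rintro ⟨b, rfl⟩
    rcases h.cover b with ⟨x, rfl⟩ | ⟨x, rfl⟩
    · exact ⟨_, (h.lam_map_add x y).symm⟩
    · exact ⟨_, (h.lam_add_add x y).symm⟩
  · rintro ⟨x, rfl⟩
    obtain ⟨w, hw | hw⟩ := hc (x - y)
    · refine ⟨ι w, (h.lam_map_add w y).trans ?_⟩
      rw [← hw, sub_add_cancel]
    -- The sign of `w` is reversed because the coset translates by `c - φ x` and not by `c + φ x`.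
    · refine ⟨ι (-w) + t, (h.lam_add_add (-w) y).trans ?_⟩
      rw [map_neg, sub_neg_eq_add, ← hw, sub_add_cancel]

theorem exists_lam_ne [Nontrivial F] (hc : CoveredBy φ c) (y : F) :
    ∃ a, SkewBrace.lam A a (ι y + t) ≠ ι y + t := by
  by_contra! H
  obtain ⟨x, hx⟩ := exists_ne (0 : F)
  have : ι (x + y) + t ∈ actionOrbit (SkewBrace.lam A) (ι y + t) := by
    rw [h.actionOrbit_map_add hc]; exact ⟨_, rfl⟩
  obtain ⟨a, ha⟩ := this
  have e := h.inj (add_right_cancel ((H a).symm.trans ha))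
  exact hx (by simpa using e.symm)

/-- The condition on the right says that `b` is fixed by `λ`, so `ι F` has a description that
isomorphisms preserve. Nontriviality of `F` is what makes every point of the other coset move. -/
theorem mem_range_iff [Nontrivial F] (hc : CoveredBy φ c) (b : A) :
    b ∈ ι.range ↔ ∀ a, a * b = a + b := by
  constructor
  · rintro ⟨x, rfl⟩ a
    exact h.mul_map a x
  · intro H
    rcases h.cover b with ⟨x, rfl⟩ | ⟨x, rfl⟩
    · exact ⟨x, rfl⟩
    · obtain ⟨a, ha⟩ := h.exists_lam_ne hc x
      refine (ha ?_).elim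
      change -a + a * (ι x + t) = _
      rw [H, neg_add_cancel_left]

end

theorem hasExactlyOneVertex {F : Type*} [AddCommGroup F] [Finite F] [Nontrivial F] {A : Type u}
    [SkewBrace A] {φ : F →+ F} {c z : F} {ι : F →+ A} {t : A}
    (h : IsDihedralExtension φ c z ι t) (hc : CoveredBy φ c) :
    (lambdaGraph A).HasExactlyOneVertex := by
  have hlt : 1 < (Set.range fun x => ι x + t).ncard := by
    obtain ⟨x, y, hxy⟩ := exists_pair_ne F
    rw [Set.one_lt_ncard_iff (Set.finite_range _)]
    exact ⟨_, _, ⟨x, rfl⟩, ⟨y, rfl⟩, fun e => hxy (h.inj (add_right_cancel e))⟩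
  have key : ∀ L : NontrivialOrbit (SkewBrace.lam A), L.1 = Set.range fun x => ι x + t := by
    rintro ⟨L, ⟨b, rfl⟩, hL⟩
    rcases h.cover b with ⟨x, rfl⟩ | ⟨x, rfl⟩
    · rw [h.actionOrbit_map, Set.ncard_singleton] at hL
      exact (lt_irrefl _ hL).elim
    · exact h.actionOrbit_map_add hc x
  refine Nat.card_eq_one_iff_unique.2 ⟨⟨fun L M => Subtype.ext ((key L).trans (key M).symm)⟩, ?_⟩
  exact ⟨⟨_, ⟨ι 0 + t, (h.actionOrbit_map_add hc 0).symm⟩, hlt⟩⟩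

/-- An isomorphism of extensions induces an isomorphism of the groups `F` that respects `φ`
and `z`. -/
theorem exists_addEquiv {F F' A B : Type*} [AddCommGroup F] [AddCommGroup F'] [SkewBrace A]
    [SkewBrace B] [Nontrivial F] [Nontrivial F'] {φ : F →+ F} {c z : F} {ι : F →+ A} {t : A}
    {φ' : F' →+ F'} {c' z' : F'} {κ : F' →+ B} {s : B}
    (h : IsDihedralExtension φ c z ι t) (h' : IsDihedralExtension φ' c' z' κ s)
    (hc : CoveredBy φ c) (hc' : CoveredBy φ' c') (E : A ≃+* B) :
    ∃ e : F ≃+ F', (∀ x, e (φ x) = φ' (e x)) ∧ e z = z' := by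
  have hE : ι.range.map (E : A ≃+ B).toAddMonoidHom = κ.range := by
    ext b
    rw [h'.mem_range_iff hc', AddSubgroup.mem_map]
    constructor
    · rintro ⟨a, ha, rfl⟩ b'
      obtain ⟨a', rfl⟩ := E.surjective b'
      have := congrArg E ((h.mem_range_iff hc a).1 ha a')
      rw [_root_.map_mul, map_add] at this
      exact this
    · intro H
      obtain ⟨a, rfl⟩ := E.surjective b
      refine ⟨a, (h.mem_range_iff hc a).2 fun a' => E.injective ?_, rfl⟩
      rw [_root_.map_mul, map_add]
      exact H _
  have hex : ∀ x, ∃ y, κ y = E (ι x) := fun x => by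
    have : E (ι x) ∈ κ.range := by
      rw [← hE]; exact ⟨ι x, ⟨x, rfl⟩, rfl⟩
    exact this
  choose f hf using hex
  have hsurj : Function.Surjective f := fun y => by
    have : κ y ∈ ι.range.map (E : A ≃+ B).toAddMonoidHom := by
      rw [hE]; exact ⟨y, rfl⟩
    obtain ⟨_, ⟨x, rfl⟩, hx⟩ := this
    exact ⟨x, h'.inj ((hf x).trans hx)⟩
  have hinj : Function.Injective f := fun x y hxy =>
    h.inj (E.injective (by rw [← hf, ← hf, hxy]))
  have hadd : ∀ x y, f (x + y) = f x + f y := fun x y => h'.inj (by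
    rw [hf, map_add, map_add, map_add, hf, hf])
  -- The isomorphism need not send `t` to `s`, only into the coset of `s`. The remaining goals hold
  -- because neither the translation `φ` nor the double of a coset element depends on the element
  -- chosen.
  have ht : ∃ y, E t = κ y + s := by
    rcases h'.cover (E t) with ⟨y, hy⟩ | hy
    · obtain ⟨x, rfl⟩ := hsurj y
      rw [hf] at hy
      exact (h.notMem x (E.injective hy).symm).elim
    · exact hy
  obtain ⟨y, hy⟩ := ht
  refine ⟨{ Equiv.ofBijective f ⟨hinj, hsurj⟩ with map_add' := hadd }, fun x => ?_, ?_⟩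
  · change f (φ x) = φ' (f x)
    have e := congrArg E (h.map_mul x)
    rw [_root_.map_mul, map_add, hy, ← hf x, ← hf, h'.map_mul_add, ← add_assoc, ← map_add] at e
    have e := h'.inj (add_right_cancel e)
    rw [hadd] at e
    exact (add_left_cancel (add_right_cancel e)).symm
  · change f z = z'
    have e := congrArg E h.add_self
    rw [map_add, hy, h'.add_add_add, sub_self, zero_add, ← hf] at e
    exact (h'.inj e).symm

end IsDihedralExtension

/-! ### From a one-vertex graph to an extension of the fixed-point group. -/

namespace SkewBrace

/-- The elements fixed by the action `λ`. -/
def lamFixed (A : Type u) [SkewBrace A] : AddSubgroup A where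
  carrier := {x | ∀ a, lam A a x = x}
  zero_mem' := fun a => map_zero _
  add_mem' := fun hx hy a => by rw [map_add, hx, hy]
  neg_mem' := fun hx a => by rw [map_neg, hx]

variable {A : Type u} [SkewBrace A]

theorem mem_lamFixed {x : A} : x ∈ lamFixed A ↔ ∀ a, lam A a x = x := Iff.rfl

theorem lam_one_apply (x : A) : lam A 1 x = x := by
  rw [map_one]; rfl

theorem lam_mul_apply (a b x : A) : lam A (a * b) x = lam A a (lam A b x) := by
  rw [map_mul]; rfl

theorem mul_eq_add_lam (a x : A) : a * x = a + lam A a x := (add_neg_cancel_left a (a * x)).symm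

theorem mem_actionOrbit_self (x : A) : x ∈ actionOrbit (lam A) x := ⟨1, lam_one_apply x⟩

theorem one_lt_ncard_actionOrbit [Finite A] {x : A} (hx : x ∉ lamFixed A) :
    1 < (actionOrbit (lam A) x).ncard := by
  rw [mem_lamFixed] at hx
  push Not at hx
  obtain ⟨a, ha⟩ := hx
  rw [Set.one_lt_ncard_iff (Set.toFinite _)]
  exact ⟨_, _, ⟨a, rfl⟩, mem_actionOrbit_self x, ha⟩

theorem notMem_lamFixed_of_one_lt_ncard {x : A} (hx : 1 < (actionOrbit (lam A) x).ncard) :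
    x ∉ lamFixed A := by
  intro h
  have : actionOrbit (lam A) x = {x} := by
    ext y
    constructor
    · rintro ⟨a, rfl⟩
      exact h a
    · rintro rfl
      exact mem_actionOrbit_self _
  rw [this, Set.ncard_singleton] at hx
  exact lt_irrefl _ hx

theorem exists_actionOrbit_eq_compl [Finite A] (hA : (lambdaGraph A).HasExactlyOneVertex) :
    ∃ t, actionOrbit (lam A) t = (lamFixed A : Set A)ᶜ ∧ 1 < (actionOrbit (lam A) t).ncard := by
  obtain ⟨hsub, ⟨⟨_, ⟨t, rfl⟩, ht⟩⟩⟩ := Nat.card_eq_one_iff_unique.1 hA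
  refine ⟨t, Set.Subset.antisymm ?_ fun y hy => ?_, ht⟩
  · rintro _ ⟨a, rfl⟩ hF
    apply notMem_lamFixed_of_one_lt_ncard ht
    have := hF a⁻¹
    rw [← lam_mul_apply, inv_mul_cancel, lam_one_apply] at this
    rw [this]
    exact hF
  · have := Subtype.ext_iff.1 (hsub.elim ⟨_, ⟨t, rfl⟩, ht⟩ ⟨_, ⟨y, rfl⟩, one_lt_ncard_actionOrbit hy⟩)
    rw [show actionOrbit (lam A) t = actionOrbit (lam A) y from this]
    exact mem_actionOrbit_self y

/-- Orbit–stabilizer for the group `(A, ∘)`. -/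
theorem ncard_actionOrbit_dvd [Finite A] (x : A) : (actionOrbit (lam A) x).ncard ∣ Nat.card A := by
  let act : MulAction A A := MulAction.compHom A (lam A)
  have := @MulAction.index_stabilizer A A _ act x
  have h2 : @MulAction.orbit A A act.toSMul x = actionOrbit (lam A) x := rfl
  rw [h2] at this
  rw [← this]
  exact Subgroup.index_dvd_card _

theorem index_lamFixed [Finite A] (hA : (lambdaGraph A).HasExactlyOneVertex) :
    (lamFixed A).index = 2 := by
  obtain ⟨t, ht, h1⟩ := exists_actionOrbit_eq_compl hA
  have hdvd := ncard_actionOrbit_dvd t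
  have hc := Set.ncard_add_ncard_compl (lamFixed A : Set A)
  rw [← ht] at hc
  have hF : (lamFixed A : Set A).ncard = Nat.card (lamFixed A) := (Nat.card_coe_set_eq _).symm
  have hm := (lamFixed A).card_mul_index
  have hpos : 0 < Nat.card (lamFixed A) := Nat.card_pos
  rw [hF] at hc
  generalize (lamFixed A).index = q at *
  generalize Nat.card (lamFixed A) = f at *
  rcases q with _ | q
  · omega
  have : (actionOrbit (lam A) t).ncard = f * q := by
    rw [← hm, mul_add] at hc
    omega
  rw [this, ← hm] at hdvd
  -- The index is now written `q + 1`: the orbit length `f * q` divides `f * (q + 1)`, so `q`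
  -- divides `q + 1`, hence `1`.
  have := Nat.dvd_of_mul_dvd_mul_left hpos hdvd
  have hq : q ∣ 1 := (Nat.dvd_add_right dvd_rfl).1 this
  rw [Nat.dvd_one.1 hq]

/-- Every coset element is `λ_a(t)` for some `a`, and `λ_a` is additive and fixes `F`. Applying such
automorphisms to elements of `F` expressed through `t` yields all the relations. -/
theorem exists_isDihedralExtension [Finite A] (hA : (lambdaGraph A).HasExactlyOneVertex) :
    ∃ (F : Type u) (_ : AddCommGroup F) (φ : F →+ F) (c z : F) (ι : F →+ A) (t : A),
      IsDihedralExtension φ c z ι t ∧ CoveredBy φ c ∧ Nontrivial F := by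
  obtain ⟨t, ht, h1⟩ := exists_actionOrbit_eq_compl hA
  have hidx := index_lamFixed hA
  have hadd : ∀ {a b : A}, a + b ∈ lamFixed A ↔ (a ∈ lamFixed A ↔ b ∈ lamFixed A) :=
    AddSubgroup.add_mem_iff_of_index_two hidx
  have htF : t ∉ lamFixed A := by
    have : t ∈ (lamFixed A : Set A)ᶜ := ht ▸ mem_actionOrbit_self t
    exact this
  have hlamF : ∀ a, lam A a t ∉ lamFixed A := fun a => by
    have : lam A a t ∈ (lamFixed A : Set A)ᶜ := ht ▸ ⟨a, rfl⟩
    exact this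
  have hsurj : ∀ y ∈ lamFixed A, ∃ a, lam A a t = y + t := fun y hy => by
    have : y + t ∈ actionOrbit (lam A) t := by
      rw [ht]
      intro hm
      exact htF ((hadd.1 hm).1 hy)
    exact this
  -- Choose `a` with `λ_a(t) = y + t`. Since `x` and its conjugate `-t + x + t` are both fixed by
  -- `λ_a`, conjugation by `t` and by `y + t` take that conjugate to the same `x`; hence `y`
  -- commutes with `x`.
  have hcomm : ∀ x ∈ lamFixed A, ∀ y ∈ lamFixed A, x + y = y + x := by
    intro x hx y hy
    obtain ⟨a, ha⟩ := hsurj y hy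
    have h2 := hx a
    have h3 : x = t + (-t + x + t) + -t := by simp [add_assoc]
    have hx' : -t + x + t ∈ lamFixed A := by
      rw [hadd, hadd, neg_mem_iff]
      tauto
    rw [h3, map_add, map_add, map_neg, ha, hx' a] at h2
    have h4 : y + x + -y = x := by
      have h5 := h2
      rw [neg_add_rev] at h5
      have h6 : y + t + (-t + x + t) + (-t + -y) = y + x + -y := by simp [add_assoc]
      rw [← h6, h5, ← h3]
    rw [add_neg_eq_iff_eq_add] at h4
    exact h4.symm
  have hz : t + t ∈ lamFixed A := hadd.2 Iff.rfl
  -- The element `t + t` is fixed, so `(y + t) + (y + t) = t + t`.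
  have hinv : ∀ y ∈ lamFixed A, t + y = -y + t := by
    intro y hy
    obtain ⟨a, ha⟩ := hsurj y hy
    have h2 := hz a
    rw [map_add, ha, ← add_assoc] at h2
    have h3 := add_right_cancel h2
    rw [eq_neg_add_iff_add_eq, ← add_assoc, h3]
  have hmul : ∀ a, ∀ x ∈ lamFixed A, a * x = a + x := fun a x hx => by
    rw [mul_eq_add_lam, hx a]
  have hf : ∀ a, lam A a t - t ∈ lamFixed A := fun a => by
    rw [sub_eq_add_neg, hadd, neg_mem_iff]
    exact iff_of_false (hlamF a) htF
  let f : A → lamFixed A := fun a => ⟨lam A a t - t, hf a⟩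
  have hft : ∀ a, lam A a t = (f a : A) + t := fun a => (sub_add_cancel _ _).symm
  -- The cocycle term `λ_a(f b)` is just `f b`, so `f` is an antihomomorphism; restricted to `F`,
  -- where `∘` agrees with `+` and addition commutes, it becomes the endomorphism `φ`.
  have hfm : ∀ a b, f (a * b) = f b + f a := fun a b => by
    apply Subtype.ext
    have : (f (a * b) : A) + t = (f b : A) + ((f a : A) + t) := by
      rw [← hft, lam_mul_apply, hft b, map_add, (f b).2 a, hft a]
    rw [← add_assoc] at this
    exact add_right_cancel this
  let _ : AddCommGroup (lamFixed A) :=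
    { (inferInstance : AddGroup (lamFixed A)) with
      add_comm := fun x y => Subtype.ext (hcomm x x.2 y y.2) }
  have hfx : ∀ x y : lamFixed A, f ((x + y : lamFixed A) : A) = f x + f y := fun x y => by
    have : ((x + y : lamFixed A) : A) = (x : A) * (y : A) := (hmul x y y.2).symm
    rw [this, hfm]
    exact add_comm _ _
  let φ : lamFixed A →+ lamFixed A := AddMonoidHom.mk' (fun x => f x) hfx
  refine ⟨lamFixed A, inferInstance, φ, f t, ⟨t + t, hz⟩,
    AddMonoidHom.mk' (fun x => (x : A)) fun _ _ => rfl, t, ⟨?_, ?_, ?_, ?_, ?_, ?_, ?_, ?_⟩, ?_, ?_⟩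
  · exact Subtype.val_injective
  · intro a
    by_cases ha : a ∈ lamFixed A
    · exact Or.inl ⟨⟨a, ha⟩, rfl⟩
    · refine Or.inr ⟨⟨a - t, ?_⟩, (sub_add_cancel a t).symm⟩
      rw [sub_eq_add_neg, hadd, neg_mem_iff]
      exact iff_of_false ha htF
  · rintro x rfl
    exact htF x.2
  · intro x
    exact hinv x x.2
  · rfl
  · intro a x
    exact hmul a x x.2
  · intro x
    change (x : A) * t = (x : A) + (f x : A) + t
    rw [mul_eq_add_lam, hft, add_assoc]
  · change t * t = ((⟨t + t, hz⟩ - f t : lamFixed A) : A)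
    rw [sub_eq_neg_add]
    change t * t = -(f t : A) + (t + t)
    rw [mul_eq_add_lam, hft, ← add_assoc, hinv _ (f t).2, add_assoc]
  · intro y
    obtain ⟨a, ha⟩ := hsurj y y.2
    have hya : y = f a := by
      apply Subtype.ext
      rw [hft] at ha
      exact (add_right_cancel ha).symm
    by_cases haF : a ∈ lamFixed A
    · exact ⟨⟨a, haF⟩, Or.inl hya⟩
    · have hx : -t + a ∈ lamFixed A := by
        rw [hadd, neg_mem_iff]
        exact iff_of_false htF haF
      refine ⟨⟨-t + a, hx⟩, Or.inr ?_⟩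
      -- An element outside `F` is `t ∘ x` with `x` in `F`, and its value under `f` is `φ x + c`.
      have : a = t * (-t + a) := by rw [hmul _ _ hx, add_neg_cancel_left]
      have hfa : f a = f (-t + a) + f t := by rw [← hfm, ← this]
      rw [hya, hfa]
      exact add_comm _ _
  · have hc := Set.ncard_add_ncard_compl (lamFixed A : Set A)
    rw [← ht, ← (lamFixed A).card_mul_index, hidx] at hc
    have hF : (lamFixed A : Set A).ncard = Nat.card (lamFixed A) := (Nat.card_coe_set_eq _).symm
    -- The orbit has more than one element, and by index two it has as many elements as `F`.
    have : 1 < Nat.card (lamFixed A) := by omega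
    exact (Finite.one_lt_card_iff_nontrivial).1 this

end SkewBrace

/-! ### The four families as extensions with explicit data. -/

/-- The endomorphism `x ↦ -2x` of an abelian group. -/
def negDouble (F : Type*) [AddCommGroup F] : F →+ F := -(AddMonoidHom.id F + AddMonoidHom.id F)

theorem negDouble_apply {F : Type*} [AddCommGroup F] (x : F) : negDouble F x = -(x + x) := rfl

theorem exists_eq_negDouble_of_odd {G : Type*} [AddCommGroup G] {d : ℕ} (hd : Odd d)
    (hG : Nat.card G = d) (y : G) : ∃ x, y = negDouble G x := by
  obtain ⟨k, rfl⟩ := hd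
  have h : (2 * k + 1) • y = 0 := by rw [← hG]; exact card_nsmul_eq_zero'
  -- With `d = 2k + 1` and `dy = 0`, the multiple `ky` satisfies `-2(ky) = y`.
  refine ⟨k • y, ?_⟩
  rw [negDouble_apply, eq_neg_iff_add_eq_zero, ← add_nsmul, ← succ_nsmul', ← h]
  congr 1
  ring

theorem coveredBy_negDouble_of_odd {G : Type*} [AddCommGroup G] {d : ℕ} (hd : Odd d)
    (hG : Nat.card G = d) (c : G) : CoveredBy (negDouble G) c := fun y =>
  (exists_eq_negDouble_of_odd hd hG y).imp fun _ => Or.inl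

/-- The parity of a representative of the first coordinate decides between the image and its
translate; the odd factor is divisible by `2` and imposes nothing. -/
theorem coveredBy_negDouble_zmod_prod {G : Type*} [AddCommGroup G] {d : ℕ} (hd : Odd d)
    (hG : Nat.card G = d) (i : ℕ) : CoveredBy (negDouble (ZMod (2 ^ i) × G)) (1, 0) := by
  rintro ⟨a, g⟩
  obtain ⟨x, hx⟩ := exists_eq_negDouble_of_odd hd hG g
  obtain ⟨n, rfl⟩ := ZMod.intCast_surjective a
  rw [negDouble_apply] at hx
  rcases Int.even_or_odd' n with ⟨k, rfl | rfl⟩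
  · refine ⟨(-(k : ZMod (2 ^ i)), x), Or.inl (Prod.ext ?_ ?_)⟩
    · simp [negDouble_apply]; ring
    · simpa [negDouble_apply] using hx
  · refine ⟨(-(k : ZMod (2 ^ i)), x), Or.inr (Prod.ext ?_ ?_)⟩
    · simp [negDouble_apply]; ring
    · simpa [negDouble_apply] using hx

/-- The endomorphism `(a, b, g) ↦ (b, 0, -2g)`. -/
def kleinHom (G : Type*) [AddCommGroup G] : ZMod 2 × ZMod 2 × G →+ ZMod 2 × ZMod 2 × G where
  toFun x := (x.2.1, 0, negDouble G x.2.2)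
  map_zero' := by simp
  map_add' x y := by simp

theorem kleinHom_apply {G : Type*} [AddCommGroup G] (x : ZMod 2 × ZMod 2 × G) :
    kleinHom G x = (x.2.1, 0, -(x.2.2 + x.2.2)) := rfl

theorem coveredBy_kleinHom {G : Type*} [AddCommGroup G] {d : ℕ} (hd : Odd d)
    (hG : Nat.card G = d) : CoveredBy (kleinHom G) (0, 1, 0) := by
  rintro ⟨a, b, g⟩
  obtain ⟨x, hx⟩ := exists_eq_negDouble_of_odd hd hG g
  rw [negDouble_apply] at hx
  rcases zmod2_cases b with rfl | rfl
  · exact ⟨(0, a, x), Or.inl (by rw [kleinHom_apply, hx])⟩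
  · exact ⟨(0, a, x), Or.inr (by rw [kleinHom_apply, hx]; simp)⟩

section Families

variable {G : Type u} [AddCommGroup G]

theorem DBrace.isDihedralExtension :
    IsDihedralExtension (negDouble G) 0 0
      (AddMonoidHom.mk' (fun x => (⟨x, 0⟩ : DBrace G)) fun x y => by
        simp [add_def, zsgn_zero]) ⟨0, 1⟩ where
  inj x y h := (DBrace.ext_iff.1 h).1
  cover := by
    rintro ⟨g, k⟩
    rcases zmod2_cases k with rfl | rfl
    · exact Or.inl ⟨g, rfl⟩
    · exact Or.inr ⟨g, by simp [add_def]⟩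
  notMem x h := zero_ne_one (DBrace.ext_iff.1 h).2
  add_conj x := by simp [add_def, zsgn_one, zsgn_zero]
  add_self := by simp [add_def, zmod2_one_add_one]
  mul_map a x := by simp [add_def, mul_def, zsgn_zero]
  map_mul x := by simp [add_def, mul_def, zsgn_zero, zsgn_one, negDouble_apply]
  mul_self := by simp [mul_def, zmod2_one_add_one]

theorem JBrace.isDihedralExtension (i : ℕ) :
    IsDihedralExtension (negDouble (ZMod (2 ^ i) × G)) (1, 0) 0
      (AddMonoidHom.mk' (fun x => (⟨x.1, x.2, 0⟩ : JBrace i G)) fun x y => by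
        simp [add_def, zsgn_zero]) ⟨0, 0, 1⟩ where
  inj x y h := Prod.ext (JBrace.ext_iff.1 h).1 (JBrace.ext_iff.1 h).2.1
  cover := by
    rintro ⟨a, g, k⟩
    rcases zmod2_cases k with rfl | rfl
    · exact Or.inl ⟨(a, g), rfl⟩
    · exact Or.inr ⟨(a, g), by simp [add_def]⟩
  notMem x h := zero_ne_one (JBrace.ext_iff.1 h).2.2
  add_conj x := by simp [add_def, zsgn_one, zsgn_zero]
  add_self := by simp [add_def, zmod2_one_add_one]
  mul_map a x := by simp [add_def, mul_def, zsgn_zero]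
  map_mul x := by simp [add_def, mul_def, zsgn_zero, zsgn_one, negDouble_apply]
  mul_self := by simp [mul_def, zmod2_one_add_one, zmod2_val_one]

theorem HBrace.isDihedralExtension (i : ℕ) :
    IsDihedralExtension (negDouble (ZMod (2 ^ i) × G)) (1, 0) (2 ^ (i - 1), 0)
      (AddMonoidHom.mk' (fun x => (⟨x.1, x.2, 0⟩ : HBrace i G)) fun x y => by
        simp [add_def, zsgn_zero, cocycle]) ⟨0, 0, 1⟩ where
  inj x y h := Prod.ext (HBrace.ext_iff.1 h).1 (HBrace.ext_iff.1 h).2.1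
  cover := by
    rintro ⟨a, g, k⟩
    rcases zmod2_cases k with rfl | rfl
    · exact Or.inl ⟨(a, g), rfl⟩
    · exact Or.inr ⟨(a, g), by simp [add_def, cocycle]⟩
  notMem x h := zero_ne_one (HBrace.ext_iff.1 h).2.2
  add_conj x := by simp [add_def, zsgn_one, zsgn_zero, cocycle]
  add_self := by simp [add_def, zmod2_one_add_one, cocycle, zmod2_val_one]
  mul_map a x := by simp [add_def, mul_def, zsgn_zero, cocycle]
  map_mul x := by simp [add_def, mul_def, zsgn_zero, zsgn_one, negDouble_apply, cocycle]
  mul_self := by simp [mul_def, zmod2_one_add_one, zmod2_val_one, cocycle, sub_eq_neg_add]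

theorem KBrace.isDihedralExtension :
    IsDihedralExtension (kleinHom G) (0, 1, 0) (0, 1, 0)
      (AddMonoidHom.mk' (fun x => (⟨x.1, x.2.1, x.2.2, 0⟩ : KBrace G)) fun x y => by
        simp [add_def, zsgn_zero]) ⟨0, 0, 0, 1⟩ where
  inj x y h := Prod.ext (KBrace.ext_iff.1 h).1
    (Prod.ext (KBrace.ext_iff.1 h).2.1 (KBrace.ext_iff.1 h).2.2.1)
  cover := by
    rintro ⟨a, b, g, k⟩
    rcases zmod2_cases k with rfl | rfl
    · exact Or.inl ⟨(a, b, g), rfl⟩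
    · exact Or.inr ⟨(a, b, g), by simp [add_def]⟩
  notMem x h := zero_ne_one (KBrace.ext_iff.1 h).2.2.2
  add_conj x := by simp [add_def, zsgn_one, zsgn_zero, ZModModule.neg_eq_self]
  add_self := by simp [add_def, zmod2_one_add_one]
  mul_map a x := by simp [add_def, mul_def, zsgn_zero]
  map_mul x := by simp [add_def, mul_def, zsgn_zero, zsgn_one, kleinHom_apply]
  mul_self := by simp [mul_def, zmod2_one_add_one]

end Families

/-! ### Primary splitting and cyclic groups. -/

theorem eq_zero_of_nsmul_eq_zero_of_coprime {F : Type*} [AddGroup F] {m n : ℕ} {x : F}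
    (hmn : m.Coprime n) (hm : m • x = 0) (hn : n • x = 0) : x = 0 := by
  rw [← AddMonoid.addOrderOf_eq_one_iff, ← Nat.dvd_one, ← hmn]
  exact Nat.dvd_gcd (addOrderOf_dvd_of_nsmul_eq_zero hm) (addOrderOf_dvd_of_nsmul_eq_zero hn)

/-- By Cauchy, a common prime of `|P|` and `n` would be the order of an element killed by `m`. -/
theorem coprime_nat_card_of_nsmul_eq_zero {P : Type*} [AddGroup P] [Finite P] {m n : ℕ}
    (hmn : m.Coprime n) (hP : ∀ x : P, m • x = 0) : (Nat.card P).Coprime n := by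
  by_contra h
  obtain ⟨p, hp, hp1, hp2⟩ := Nat.Prime.not_coprime_iff_dvd.1 h
  have := Fact.mk hp
  obtain ⟨x, hx⟩ := exists_prime_addOrderOf_dvd_card' p hp1
  have h2 := addOrderOf_dvd_of_nsmul_eq_zero (hP x)
  rw [hx] at h2
  exact Nat.Prime.not_coprime_iff_dvd.2 ⟨p, hp, h2, hp2⟩ hmn

/-- The factors are the `m`-torsion and the `n`-torsion, and a Bézout relation splits each element.
Their orders divide `m` and `n` respectively and have product `mn`, so they are equal to these. -/
theorem exists_addEquiv_prod_of_coprime {F : Type u} [AddCommGroup F] [Finite F] {m n : ℕ}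
    (hmn : m.Coprime n) (hF : Nat.card F = m * n) :
    ∃ (P G : Type u) (_ : AddCommGroup P) (_ : AddCommGroup G),
      Nat.card P = m ∧ Nat.card G = n ∧ Nonempty (P × G ≃+ F) := by
  let P := (nsmulAddMonoidHom (α := F) m).ker
  let G := (nsmulAddMonoidHom (α := F) n).ker
  have hP : ∀ x : P, m • x = 0 := fun x => Subtype.ext (AddMonoidHom.mem_ker.1 x.2)
  have hG : ∀ x : G, n • x = 0 := fun x => Subtype.ext (AddMonoidHom.mem_ker.1 x.2)
  let f : P × G →+ F := P.subtype.coprod G.subtype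
  have hbez : (m : ℤ) * m.gcdA n + n * m.gcdB n = 1 := by
    rw [← Nat.gcd_eq_gcd_ab, hmn]; rfl
  have hf : Function.Bijective f := by
    constructor
    · rw [injective_iff_map_eq_zero]
      rintro ⟨p, g⟩ h
      have h : (p : F) + g = 0 := h
      have hp : n • (p : F) = 0 := by
        rw [eq_neg_of_add_eq_zero_left h, smul_neg]
        exact neg_eq_zero.2 (congrArg Subtype.val (hG g))
      have hp0 : (p : F) = 0 :=
        eq_zero_of_nsmul_eq_zero_of_coprime hmn (congrArg Subtype.val (hP p)) hp
      rw [hp0, zero_add] at h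
      exact Prod.ext (Subtype.ext hp0) (Subtype.ext h)
    · intro x
      have hx : ((m * n : ℕ) : ℤ) • x = 0 := by
        rw [natCast_zsmul, ← hF]; exact card_nsmul_eq_zero'
      refine ⟨(⟨((n : ℤ) * m.gcdB n) • x, ?_⟩, ⟨((m : ℤ) * m.gcdA n) • x, ?_⟩), ?_⟩
      · rw [AddMonoidHom.mem_ker, nsmulAddMonoidHom_apply, ← natCast_zsmul, smul_smul,
          ← mul_assoc, mul_comm, ← smul_smul, ← Nat.cast_mul, hx, smul_zero]
      · rw [AddMonoidHom.mem_ker, nsmulAddMonoidHom_apply, ← natCast_zsmul, smul_smul,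
          ← mul_assoc, mul_comm, ← smul_smul, ← Nat.cast_mul, mul_comm n m, hx, smul_zero]
      · change ((n : ℤ) * m.gcdB n) • x + ((m : ℤ) * m.gcdA n) • x = x
        rw [← add_smul, add_comm, hbez, one_smul]
  have hcard : Nat.card P * Nat.card G = m * n := by
    rw [← Nat.card_prod, ← hF]
    exact Nat.card_congr (Equiv.ofBijective f hf)
  have h1 : Nat.card P ∣ m := (coprime_nat_card_of_nsmul_eq_zero hmn hP).dvd_of_dvd_mul_right
    (hcard ▸ dvd_mul_right _ _)
  have h2 : Nat.card G ∣ n := (coprime_nat_card_of_nsmul_eq_zero hmn.symm hG).dvd_of_dvd_mul_left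
    (hcard ▸ dvd_mul_left _ _)
  have hmn0 : m * n ≠ 0 := hF ▸ Nat.card_pos.ne'
  have h3 : Nat.card P ≤ m := Nat.le_of_dvd (Nat.pos_of_ne_zero (left_ne_zero_of_mul hmn0)) h1
  have h4 : Nat.card G ≤ n := Nat.le_of_dvd (Nat.pos_of_ne_zero (right_ne_zero_of_mul hmn0)) h2
  have hm0 := Nat.pos_of_ne_zero (left_ne_zero_of_mul hmn0)
  have hn0 := Nat.pos_of_ne_zero (right_ne_zero_of_mul hmn0)
  exact ⟨P, G, inferInstance, inferInstance, by nlinarith, by nlinarith,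
    ⟨AddEquiv.ofBijective f hf⟩⟩

/-- A subgroup `S` of a `2`-group with `S ⊆ H + 2S` is contained in `H`. -/
theorem AddSubgroup.le_of_forall_exists_add_double {P : Type*} [AddCommGroup P] {i : ℕ}
    (hP : Nat.card P = 2 ^ i) (S H : AddSubgroup P)
    (hS : ∀ s ∈ S, ∃ x ∈ H, ∃ y ∈ S, s = x + (y + y)) : S ≤ H := by
  -- Iterating the hypothesis gives `S ⊆ H + 2^k S`; at `k = i` the second term vanishes.
  have key : ∀ k : ℕ, ∀ s ∈ S, ∃ x ∈ H, ∃ y ∈ S, s = x + 2 ^ k • y := by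
    intro k
    induction k with
    | zero => exact fun s hs => ⟨0, H.zero_mem, s, hs, by simp⟩
    | succ k ih =>
      intro s hs
      obtain ⟨x, hx, y, hy, rfl⟩ := ih s hs
      obtain ⟨x', hx', y', hy', rfl⟩ := hS y hy
      refine ⟨x + 2 ^ k • x', H.add_mem hx (H.nsmul_mem hx' _), y', hy', ?_⟩
      rw [nsmul_add, ← add_assoc, ← two_nsmul, ← mul_nsmul', ← pow_succ]
  intro s hs
  obtain ⟨x, hx, y, -, rfl⟩ := key i s hs
  rw [← hP, card_nsmul_eq_zero', add_zero]
  exact hx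

theorem exists_zmod_addMonoidHom {P : Type*} [AddCommGroup P] (n : ℕ) {x : P}
    (hx : n • x = 0) : ∃ f : ZMod n →+ P, f 1 = x ∧ ∀ k : ℤ, f k = k • x := by
  refine ⟨ZMod.lift n ⟨zmultiplesHom P x, by simpa using hx⟩, ?_, fun k => by simp⟩
  have := ZMod.lift_coe n ⟨zmultiplesHom P x, by simpa using hx⟩ 1
  simpa using this

theorem exists_zmod_addEquiv_of_zmultiples_eq_top {P : Type*} [AddCommGroup P] {n : ℕ} [NeZero n]
    (hP : Nat.card P = n) {c : P} (hc : AddSubgroup.zmultiples c = ⊤) :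
    ∃ e : ZMod n ≃+ P, e 1 = c := by
  obtain ⟨f, hf1, hf⟩ := exists_zmod_addMonoidHom n (x := c) (by
    rw [← hP]; exact card_nsmul_eq_zero')
  have hs : Function.Surjective f := fun y => by
    obtain ⟨k, hk⟩ := AddSubgroup.mem_zmultiples_iff.1 (hc ▸ AddSubgroup.mem_top y)
    exact ⟨k, (hf k).trans hk⟩
  have hb := hs.bijective_of_nat_card_le (by rw [hP, Nat.card_zmod])
  exact ⟨AddEquiv.ofBijective f hb, hf1⟩

theorem ZMod.eq_zero_or_eq_of_add_self_eq_zero (i : ℕ) (a : ZMod (2 ^ (i + 1))) (ha : a + a = 0) :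
    a = 0 ∨ a = 2 ^ i := by
  have h : ((a.val + a.val : ℕ) : ZMod (2 ^ (i + 1))) = 0 := by
    rw [Nat.cast_add, ZMod.natCast_zmod_val, ha]
  rw [ZMod.natCast_eq_zero_iff, ← two_mul] at h
  have h := Nat.dvd_of_mul_dvd_mul_left two_pos ((pow_succ' 2 i).symm.dvd.trans h)
  obtain ⟨k, hk⟩ := h
  have hlt := ZMod.val_lt a
  rw [hk, pow_succ] at hlt
  have hk2 : k < 2 := lt_of_mul_lt_mul_left hlt (Nat.zero_le _)
  have ha' := ZMod.natCast_zmod_val a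
  rw [hk] at ha'
  interval_cases k
  · left; rw [← ha']; simp
  · right; rw [← ha']; simp

/-! ### Solving the equations on the 2-part. -/

section TwoGroup

variable {P : Type*} [AddCommGroup P] {i : ℕ} {ψ : P →+ P} {c z : P}

/-- Applying `ψ` to the covering of `P`, with `ψ² = -2ψ` and `ψ c = -2c`, puts `ψP` inside `⟨c⟩ +
2ψP`, hence inside `⟨c⟩`. The covering then gives `P = ⟨c⟩`, and `ψ` is `-2` on the generator. -/
theorem zmultiples_eq_top_of_coveredBy (hP : Nat.card P = 2 ^ i)
    (hψ : ∀ x, ψ (ψ x) = -(ψ x + ψ x)) (hcov : CoveredBy ψ c) (hc : ψ c = -(c + c)) :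
    AddSubgroup.zmultiples c = ⊤ ∧ ψ = negDouble P := by
  have hr : ψ.range ≤ AddSubgroup.zmultiples c := by
    refine AddSubgroup.le_of_forall_exists_add_double hP _ _ ?_
    rintro _ ⟨y, rfl⟩
    obtain ⟨x, rfl | rfl⟩ := hcov y
    · exact ⟨0, zero_mem _, -ψ x, neg_mem ⟨x, rfl⟩, by rw [hψ]; abel⟩
    · have hm := AddSubgroup.mem_zmultiples c
      exact ⟨-(c + c), neg_mem (add_mem hm hm), -ψ x, neg_mem ⟨x, rfl⟩, by
        rw [map_add, hψ, hc]; abel⟩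
  have htop : AddSubgroup.zmultiples c = ⊤ := by
    rw [eq_top_iff]
    intro y _
    obtain ⟨x, rfl | rfl⟩ := hcov y
    · exact hr ⟨x, rfl⟩
    · exact add_mem (AddSubgroup.mem_zmultiples c) (hr ⟨x, rfl⟩)
  refine ⟨htop, ?_⟩
  ext y
  obtain ⟨k, rfl⟩ := AddSubgroup.mem_zmultiples_iff.1 (htop ▸ AddSubgroup.mem_top y)
  rw [map_zsmul, map_zsmul, hc, negDouble_apply]

/-- The hypothesis on `c` amounts to `ψ z ≠ 0`. Then `z` is outside `ψP`, as otherwise `ψ z = -2z =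
0`, and so `z` lies in `c + ψP`. The iteration argument gives `ψP = ⟨ψ z⟩`, of order two, and the
covering leaves only the four combinations of `ψ z` and `z`. -/
theorem exists_klein_addEquiv_of_coveredBy (hP : Nat.card P = 2 ^ i) (hz : z + z = 0)
    (hψ : ∀ x, ψ (ψ x) = -(ψ x + ψ x)) (hcz : ψ (z - c) = c + c) (hcov : CoveredBy ψ c)
    (hc : ψ c ≠ -(c + c)) :
    i = 2 ∧ (∃ x, c - ψ x = z) ∧
      ∃ e : ZMod 2 × ZMod 2 ≃+ P, (∀ a b, ψ (e (a, b)) = e (b, 0)) ∧ e (0, 1) = z := by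
  have hw0 : ψ z ≠ 0 := fun h => hc (by
    rw [map_sub, h, zero_sub] at hcz
    rw [← hcz, neg_neg])
  have hww : ψ z + ψ z = 0 := by rw [← map_add, hz, map_zero]
  have hψw : ψ (ψ z) = 0 := by rw [hψ, hww, neg_zero]
  have hzr : ∀ x, z ≠ ψ x := by
    intro x hx
    apply hw0
    rw [hx, hψ, ← hx, hz, neg_zero]
  obtain ⟨x₀, hx₀⟩ : ∃ x, z = c + ψ x := by
    obtain ⟨x, hx | hx⟩ := hcov z
    · exact (hzr x hx).elim
    · exact ⟨x, hx⟩
  have hc' : c = z - ψ x₀ := by rw [hx₀, add_sub_cancel_right]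
  have hr : ψ.range ≤ AddSubgroup.zmultiples (ψ z) := by
    refine AddSubgroup.le_of_forall_exists_add_double hP _ _ ?_
    rintro _ ⟨y, rfl⟩
    obtain ⟨x, rfl | rfl⟩ := hcov y
    · exact ⟨0, zero_mem _, -ψ x, neg_mem ⟨x, rfl⟩, by rw [hψ]; abel⟩
    · exact ⟨ψ z, AddSubgroup.mem_zmultiples _, ψ x₀ - ψ x, sub_mem ⟨x₀, rfl⟩ ⟨x, rfl⟩, by
        rw [hc', map_add, map_sub, hψ, hψ]; abel⟩
  obtain ⟨f, hf1, hf⟩ := exists_zmod_addMonoidHom 2 (x := ψ z) (by rw [two_nsmul, hww])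
  obtain ⟨g, hg1, hg⟩ := exists_zmod_addMonoidHom 2 (x := z) (by rw [two_nsmul, hz])
  have hfr : ∀ x, ∃ a, ψ x = f a := fun x => by
    obtain ⟨k, hk⟩ := AddSubgroup.mem_zmultiples_iff.1 (hr ⟨x, rfl⟩)
    exact ⟨k, by rw [hf, hk]⟩
  have hbij : Function.Bijective (f.coprod g) := by
    constructor
    · rw [injective_iff_map_eq_zero]
      rintro ⟨a, b⟩ h
      rw [AddMonoidHom.coprod_apply] at h
      rcases zmod2_cases b with rfl | rfl
      · rcases zmod2_cases a with rfl | rfl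
        · rfl
        · rw [map_zero, add_zero, hf1] at h
          exact (hw0 h).elim
      · rcases zmod2_cases a with rfl | rfl
        · rw [map_zero, zero_add, hg1] at h
          exact (hzr 0 (by rw [h, map_zero])).elim
        · rw [hf1, hg1] at h
          refine (hzr (-z) ?_).elim
          rw [map_neg]
          exact eq_neg_of_add_eq_zero_right h
    · intro y
      obtain ⟨x, rfl | rfl⟩ := hcov y
      · obtain ⟨a, ha⟩ := hfr x
        exact ⟨(a, 0), by simp [ha]⟩
      · obtain ⟨a, ha⟩ := hfr (x - x₀)
        refine ⟨(a, 1), ?_⟩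
        rw [AddMonoidHom.coprod_apply, ← ha, hg1, hc', map_sub]
        abel
  have hi : i = 2 := by
    have := Nat.card_congr (Equiv.ofBijective _ hbij)
    rw [Nat.card_prod, Nat.card_zmod, hP] at this
    exact (Nat.pow_right_injective le_rfl (this : 2 ^ 2 = 2 ^ i)).symm
  refine ⟨hi, ⟨-x₀, by rw [map_neg, sub_neg_eq_add, hx₀]⟩, AddEquiv.ofBijective _ hbij,
    fun a b => ?_, ?_⟩
  · change ψ (f a + g b) = f b + g 0
    rw [map_add, map_zero, add_zero]
    have h1 : ψ (f a) = 0 := by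
      rcases zmod2_cases a with rfl | rfl
      · simp
      · rw [hf1, hψw]
    have h2 : ψ (g b) = f b := by
      rcases zmod2_cases b with rfl | rfl
      · simp
      · rw [hf1, hg1]
    rw [h1, h2, zero_add]
  · change f 0 + g 1 = z
    rw [map_zero, zero_add, hg1]

end TwoGroup

/-! ### Solving the equations on the odd part. -/

theorem eq_negDouble_of_coveredBy_of_odd {G : Type*} [AddCommGroup G] {d : ℕ} (hd : Odd d)
    (hG : Nat.card G = d) {χ : G →+ G} {c z : G} (hz : z + z = 0)
    (hχ : ∀ x, χ (χ x) = -(χ x + χ x)) (hcz : χ (z - c) = c + c) (hcov : CoveredBy χ c) :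
    χ = negDouble G ∧ z = 0 ∧ ∃ v, c = χ v := by
  have hdz : ∀ x : G, d • x = 0 := fun x => hG ▸ card_nsmul_eq_zero'
  have hcr : ∃ v, c = χ v := by
    obtain ⟨k, rfl⟩ := hd
    -- With `d = 2k + 1`, `c = -k(2c)` and `2c = χ(z - c)`.
    refine ⟨-(k • (z - c)), ?_⟩
    have h := hdz c
    rw [succ_nsmul', mul_comm, mul_nsmul', two_nsmul] at h
    rw [map_neg, map_nsmul, hcz]
    exact eq_neg_of_add_eq_zero_left h
  refine ⟨?_, ?_, hcr⟩
  -- Since `c` is in the image, the covering makes `χ` surjective, and `χ² = -2χ` determines `χ` on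
  -- its image.
  · obtain ⟨v, rfl⟩ := hcr
    ext y
    obtain ⟨x, rfl | rfl⟩ := hcov y
    · exact hχ x
    · rw [← map_add]
      exact hχ _
  · exact eq_zero_of_nsmul_eq_zero_of_coprime (Nat.coprime_two_left.2 hd)
      (by rw [two_nsmul, hz]) (hdz z)

theorem AddMonoidHom.eq_zero_of_coprime_card {P G : Type*} [AddGroup P] [AddGroup G]
    (hPG : (Nat.card P).Coprime (Nat.card G)) (f : P →+ G) (x : P) : f x = 0 :=
  eq_zero_of_nsmul_eq_zero_of_coprime hPG
    (by rw [← map_nsmul, card_nsmul_eq_zero', map_zero]) card_nsmul_eq_zero'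

/-! ### Completeness of the list. -/

namespace IsDihedralExtension

theorem exists_iso_of_prod {P G : Type u} [AddCommGroup P] [AddCommGroup G] {A : Type u}
    [SkewBrace A] {i d : ℕ} (hd : Odd d) (hP : Nat.card P = 2 ^ i) (hG : Nat.card G = d)
    {φ : P × G →+ P × G} {c z : P × G} {ι : P × G →+ A} {t : A}
    (h : IsDihedralExtension φ c z ι t) (hcov : CoveredBy φ c) :
    (i = 0 ∧ Nonempty (SkewBraceIso A (DBrace G))) ∨
      (1 ≤ i ∧ Nonempty (SkewBraceIso A (JBrace i G))) ∨
      (1 ≤ i ∧ Nonempty (SkewBraceIso A (HBrace i G))) ∨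
      (i = 2 ∧ Nonempty (SkewBraceIso A (KBrace G))) := by
  have hco : (Nat.card P).Coprime (Nat.card G) := by
    rw [hP, hG]
    exact (Nat.coprime_two_left.2 hd).pow_left i
  let ψ : P →+ P := ((AddMonoidHom.fst P G).comp φ).comp (AddMonoidHom.inl P G)
  let χ : G →+ G := ((AddMonoidHom.snd P G).comp φ).comp (AddMonoidHom.inr P G)
  have hφ : ∀ p g, φ (p, g) = (ψ p, χ g) := by
    intro p g
    have h1 : (φ (p, 0)).2 = 0 := (((AddMonoidHom.snd P G).comp φ).comp
      (AddMonoidHom.inl P G)).eq_zero_of_coprime_card hco p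
    have h2 : (φ (0, g)).1 = 0 := (((AddMonoidHom.fst P G).comp φ).comp
      (AddMonoidHom.inr P G)).eq_zero_of_coprime_card hco.symm g
    have h3 : ((p, g) : P × G) = (p, 0) + (0, g) := by simp
    rw [h3, map_add]
    exact Prod.ext (by rw [Prod.fst_add, h2, add_zero]; rfl)
      (by rw [Prod.snd_add, h1, zero_add]; rfl)
  have hφφ : ∀ x : P × G, φ x = (ψ x.1, χ x.2) := fun x => hφ x.1 x.2
  obtain ⟨c₁, c₂⟩ := c
  obtain ⟨z₁, z₂⟩ := z
  have hz := h.two_smul_add_self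
  have hmm := h.map_map
  have hcz := h.map_sub_eq
  simp only [hφφ, Prod.ext_iff, Prod.fst_add, Prod.snd_add, Prod.fst_sub, Prod.snd_sub,
    Prod.fst_neg, Prod.snd_neg, Prod.fst_zero, Prod.snd_zero] at hz hmm hcz
  have hcov1 : CoveredBy ψ c₁ := fun y => by
    obtain ⟨x, hx⟩ := hcov (y, 0)
    simp only [hφφ, Prod.ext_iff, Prod.fst_add] at hx
    exact ⟨x.1, hx.imp And.left And.left⟩
  have hcov2 : CoveredBy χ c₂ := fun y => by
    obtain ⟨x, hx⟩ := hcov (0, y)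
    simp only [hφφ, Prod.ext_iff, Prod.snd_add] at hx
    exact ⟨x.2, hx.imp And.right And.right⟩
  obtain ⟨hχ, rfl, v, rfl⟩ := eq_negDouble_of_coveredBy_of_odd hd hG hz.2
    (fun x => (hmm (0, x)).2) hcz.2 hcov2
  -- This choice of `t` kills the odd component of `c`.
  have h := h.shift (0, v)
  have hc0 : (c₁, χ v) - φ (0, v) = (c₁, 0) := by simp [hφ]
  rw [hc0] at h
  by_cases hc : ψ c₁ = -(c₁ + c₁)
  · obtain ⟨htop, hψ⟩ := zmultiples_eq_top_of_coveredBy hP (fun x => (hmm (x, 0)).1) hcov1 hc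
    obtain ⟨e, he⟩ := exists_zmod_addEquiv_of_zmultiples_eq_top hP htop
    have hφe : ∀ x, (e.prodCongr (AddEquiv.refl G)) (negDouble (ZMod (2 ^ i) × G) x) =
        φ (e.prodCongr (AddEquiv.refl G) x) := fun x => by
      rw [hφφ, hψ, hχ, negDouble_apply, map_neg, map_add]
      rfl
    obtain ⟨a, rfl⟩ := e.surjective z₁
    rcases i with _ | i
    · left
      have : Subsingleton P := e.symm.toEquiv.subsingleton_congr.2
        (inferInstanceAs (Subsingleton (ZMod 1)))
      let u : Unique P := uniqueOfSubsingleton 0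
      refine ⟨rfl, (h.comap (AddEquiv.uniqueProd (M := G) (N := P)).symm (fun x => ?_) ?_
        ?_).nonempty_ringEquiv DBrace.isDihedralExtension⟩
      · rw [hφφ, hχ]
        exact Prod.ext (Subsingleton.elim _ _) rfl
      · exact Prod.ext (Subsingleton.elim _ _) rfl
      · exact Prod.ext (Subsingleton.elim _ _) rfl
    · have ha : a + a = 0 := e.injective (by rw [map_add, hz.1, map_zero])
      rcases ZMod.eq_zero_or_eq_of_add_self_eq_zero i a ha with rfl | rfl
      · right; left
        exact ⟨by omega, (h.comap (c' := (1, 0)) (z' := 0) _ hφe (Prod.ext he rfl)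
          (Prod.ext rfl rfl)).nonempty_ringEquiv (JBrace.isDihedralExtension (i + 1))⟩
      · right; right; left
        exact ⟨by omega, (h.comap (c' := (1, 0)) (z' := (2 ^ (i + 1 - 1), 0)) _ hφe (Prod.ext he rfl)
          (Prod.ext rfl rfl)).nonempty_ringEquiv (HBrace.isDihedralExtension (i + 1))⟩
  · right; right; right
    obtain ⟨hi, ⟨x, hx⟩, e, he, he1⟩ := exists_klein_addEquiv_of_coveredBy hP hz.1
      (fun x => (hmm (x, 0)).1) hcz.1 hcov1 hc
    -- In the Klein case this second change of `t` makes `c` equal to `z`, as in `K`.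
    have h := h.shift (x, 0)
    have hc1 : (c₁, (0 : G)) - φ (x, 0) = (z₁, 0) := by simp [hφ, hx]
    rw [hc1] at h
    refine ⟨hi, (h.comap (AddEquiv.prodAssoc.symm.trans (e.prodCongr (AddEquiv.refl G)))
      (fun x => ?_) ?_ ?_).nonempty_ringEquiv KBrace.isDihedralExtension⟩
    · obtain ⟨a, b, g⟩ := x
      rw [hφφ, hχ]
      exact Prod.ext (he a b).symm rfl
    · exact Prod.ext he1 rfl
    · exact Prod.ext he1 rfl

end IsDihedralExtension

theorem SkewBrace.exists_iso_of_hasExactlyOneVertex {A : Type u} [SkewBrace A] [Finite A]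
    {m d : ℕ} (hd : Odd d) (hcard : Nat.card A = 2 ^ m * d)
    (hA : (lambdaGraph A).HasExactlyOneVertex) :
    m ≠ 0 ∧ ∃ (G : Type u) (_ : AddCommGroup G), Nat.card G = d ∧
      ((m = 1 ∧ d ≠ 1 ∧ Nonempty (SkewBraceIso A (DBrace G))) ∨
        (2 ≤ m ∧ Nonempty (SkewBraceIso A (JBrace (m - 1) G))) ∨
        (2 ≤ m ∧ Nonempty (SkewBraceIso A (HBrace (m - 1) G))) ∨
        (m = 3 ∧ Nonempty (SkewBraceIso A (KBrace G)))) := by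
  obtain ⟨F, _, φ, c, z, ι, t, h, hcov, hF⟩ := exists_isDihedralExtension hA
  have hFA := h.nat_card
  rw [hcard] at hFA
  rcases m with _ | i
  · rw [pow_zero, one_mul] at hFA
    exact (Nat.not_even_iff_odd.2 hd (hFA ▸ even_two_mul _)).elim
  refine ⟨i.succ_ne_zero, ?_⟩
  rw [pow_succ', mul_assoc] at hFA
  have hFc : Nat.card F = 2 ^ i * d := (Nat.eq_of_mul_eq_mul_left two_pos hFA).symm
  have : Finite F := Finite.of_injective ι h.inj
  obtain ⟨P, G, _, _, hP, hG, ⟨e⟩⟩ := exists_addEquiv_prod_of_coprime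
    ((Nat.coprime_two_left.2 hd).pow_left i) hFc
  have h' := h.comap e (φ' := (e.symm.toAddMonoidHom.comp φ).comp e.toAddMonoidHom)
    (c' := e.symm c) (z' := e.symm z) (by simp) (by simp) (by simp)
  have hcov' : CoveredBy ((e.symm.toAddMonoidHom.comp φ).comp e.toAddMonoidHom) (e.symm c) := by
    intro y
    obtain ⟨x, hx⟩ := hcov (e y)
    refine ⟨e.symm x, hx.imp (fun hx => ?_) fun hx => ?_⟩
    · rw [← e.symm_apply_apply y, hx]; simp
    · rw [← e.symm_apply_apply y, hx]; simp
  refine ⟨G, inferInstance, hG, ?_⟩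
  rw [Nat.add_sub_cancel]
  rcases h'.exists_iso_of_prod hd hP hG hcov' with ⟨rfl, hi⟩ | ⟨h1, hi⟩ | ⟨h1, hi⟩ | ⟨h1, hi⟩
  · refine Or.inl ⟨rfl, ?_, hi⟩
    -- Here `|F| = d`, so `d = 1` contradicts nontriviality of `F`.
    rintro rfl
    have := (Finite.one_lt_card_iff_nontrivial).2 hF
    omega
  · exact Or.inr (Or.inl ⟨by omega, hi⟩)
  · exact Or.inr (Or.inr (Or.inl ⟨by omega, hi⟩))
  · exact Or.inr (Or.inr (Or.inr ⟨by omega, hi⟩))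

/-! ### Sizes, one-vertex graphs and absence of repetitions. -/

/-- Homomorphisms between groups of coprime orders vanish, so `e` carries `G` into `G'`; injectivity
and equal orders finish. -/
theorem nonempty_addEquiv_of_prod {P P' G G' : Type*} [AddCommGroup P] [AddCommGroup P']
    [AddCommGroup G] [AddCommGroup G'] [Finite G] (hP : (Nat.card P').Coprime (Nat.card G))
    (hG : Nat.card G = Nat.card G') (e : P × G ≃+ P' × G') : Nonempty (G ≃+ G') := by
  have : Finite G' := Nat.finite_of_card_ne_zero (hG ▸ Nat.card_pos.ne')
  let f : G →+ G' := ((AddMonoidHom.snd P' G').comp e.toAddMonoidHom).comp (AddMonoidHom.inr P G)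
  have hf : Function.Injective f := by
    rw [injective_iff_map_eq_zero]
    intro g hg
    have h1 : (e (0, g)).1 = 0 := (((AddMonoidHom.fst P' G').comp e.toAddMonoidHom).comp
      (AddMonoidHom.inr P G)).eq_zero_of_coprime_card hP.symm g
    have h2 : e (0, g) = 0 := Prod.ext h1 hg
    exact congrArg Prod.snd (e.map_eq_zero_iff.1 h2)
  exact ⟨AddEquiv.ofBijective f (hf.bijective_of_nat_card_le hG.ge)⟩

theorem nonempty_addEquiv_of_zmod_prod {P G G' : Type*} [AddCommGroup P] [AddCommGroup G]
    [AddCommGroup G'] {i d : ℕ} (hd : Odd d) (hG : Nat.card G = d) (hG' : Nat.card G' = d)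
    (e : P × G ≃+ ZMod (2 ^ i) × G') : Nonempty (G ≃+ G') := by
  have : Finite G := Nat.finite_of_card_ne_zero (hG ▸ hd.pos.ne')
  refine nonempty_addEquiv_of_prod ?_ (hG.trans hG'.symm) e
  rw [Nat.card_zmod, hG]
  exact (Nat.coprime_two_left.2 hd).pow_left i

theorem ZMod.nontrivial_two_pow {i : ℕ} (hi : 1 ≤ i) : Nontrivial (ZMod (2 ^ i)) :=
  ZMod.nontrivial_iff.2 (Nat.one_lt_two_pow (by omega)).ne'

section Classification

variable {G G' : Type u} [AddCommGroup G] [AddCommGroup G'] {i d : ℕ}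

namespace DBrace

theorem nat_card (hG : Nat.card G = d) : Nat.card (DBrace G) = 2 ^ 1 * d := by
  rw [(isDihedralExtension (G := G)).nat_card, hG, pow_one]

theorem hasExactlyOneVertex (hd : Odd d) (hG : Nat.card G = d) (h1 : d ≠ 1) :
    (lambdaGraph (DBrace G)).HasExactlyOneVertex := by
  have : Finite G := Nat.finite_of_card_ne_zero (hG ▸ hd.pos.ne')
  have : Nontrivial G := Finite.one_lt_card_iff_nontrivial.1 (by have := hd.pos; omega)
  exact isDihedralExtension.hasExactlyOneVertex (coveredBy_negDouble_of_odd hd hG 0)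

theorem nonempty_iso_iff (hd : Odd d) (hG : Nat.card G = d) (hG' : Nat.card G' = d) :
    Nonempty (SkewBraceIso (DBrace G) (DBrace G')) ↔ Nonempty (G ≃+ G') := by
  constructor
  · rintro ⟨E⟩
    -- For `d = 1` the group `F` is trivial and `exists_addEquiv` does not apply, but then both
    -- groups are trivial.
    by_cases h1 : d = 1
    · have := (Nat.card_eq_one_iff_unique.1 (hG.trans h1)).1
      have := (Nat.card_eq_one_iff_unique.1 (hG'.trans h1)).1
      exact ⟨⟨⟨fun _ => 0, fun _ => 0, fun _ => Subsingleton.elim _ _,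
        fun _ => Subsingleton.elim _ _⟩, fun _ _ => Subsingleton.elim _ _⟩⟩
    · have : Finite G := Nat.finite_of_card_ne_zero (hG ▸ hd.pos.ne')
      have : Finite G' := Nat.finite_of_card_ne_zero (hG' ▸ hd.pos.ne')
      have : Nontrivial G := Finite.one_lt_card_iff_nontrivial.1 (by have := hd.pos; omega)
      have : Nontrivial G' := Finite.one_lt_card_iff_nontrivial.1 (by have := hd.pos; omega)
      obtain ⟨e, -⟩ := isDihedralExtension.exists_addEquiv isDihedralExtension
        (coveredBy_negDouble_of_odd hd hG 0) (coveredBy_negDouble_of_odd hd hG' 0) E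
      exact ⟨e⟩
  · rintro ⟨e⟩
    exact isDihedralExtension.nonempty_ringEquiv (isDihedralExtension.comap e
      (fun x => by simp [negDouble_apply]) (map_zero e) (map_zero e))

end DBrace

theorem prodCongr_negDouble (P : Type*) [AddCommGroup P] (e : G ≃+ G') (x : P × G) :
    (AddEquiv.refl P).prodCongr e (negDouble _ x) =
      negDouble _ ((AddEquiv.refl P).prodCongr e x) := by
  rw [negDouble_apply, map_neg, map_add, negDouble_apply]

namespace JBrace

theorem nat_card (i : ℕ) (hG : Nat.card G = d) : Nat.card (JBrace i G) = 2 ^ (i + 1) * d := by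
  rw [(isDihedralExtension (G := G) i).nat_card, Nat.card_prod, Nat.card_zmod, hG, pow_succ']
  ring

theorem hasExactlyOneVertex (hi : 1 ≤ i) (hd : Odd d) (hG : Nat.card G = d) :
    (lambdaGraph (JBrace i G)).HasExactlyOneVertex := by
  have : Finite G := Nat.finite_of_card_ne_zero (hG ▸ hd.pos.ne')
  have := ZMod.nontrivial_two_pow hi
  exact (isDihedralExtension i).hasExactlyOneVertex (coveredBy_negDouble_zmod_prod hd hG i)

theorem nonempty_iso_iff (hi : 1 ≤ i) (hd : Odd d) (hG : Nat.card G = d)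
    (hG' : Nat.card G' = d) :
    Nonempty (SkewBraceIso (JBrace i G) (JBrace i G')) ↔ Nonempty (G ≃+ G') := by
  have := ZMod.nontrivial_two_pow hi
  constructor
  · rintro ⟨E⟩
    obtain ⟨e, -⟩ := (isDihedralExtension i).exists_addEquiv (isDihedralExtension i)
      (coveredBy_negDouble_zmod_prod hd hG i) (coveredBy_negDouble_zmod_prod hd hG' i) E
    exact nonempty_addEquiv_of_zmod_prod hd hG hG' e
  · rintro ⟨e⟩
    exact (isDihedralExtension i).nonempty_ringEquiv ((isDihedralExtension i).comap
      ((AddEquiv.refl _).prodCongr e) (prodCongr_negDouble _ e)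
      (Prod.ext rfl (map_zero e)) (Prod.ext rfl (map_zero e)))

end JBrace

namespace HBrace

theorem nat_card (i : ℕ) (hG : Nat.card G = d) : Nat.card (HBrace i G) = 2 ^ (i + 1) * d := by
  rw [(isDihedralExtension (G := G) i).nat_card, Nat.card_prod, Nat.card_zmod, hG, pow_succ']
  ring

theorem hasExactlyOneVertex (hi : 1 ≤ i) (hd : Odd d) (hG : Nat.card G = d) :
    (lambdaGraph (HBrace i G)).HasExactlyOneVertex := by
  have : Finite G := Nat.finite_of_card_ne_zero (hG ▸ hd.pos.ne')
  have := ZMod.nontrivial_two_pow hi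
  exact (isDihedralExtension i).hasExactlyOneVertex (coveredBy_negDouble_zmod_prod hd hG i)

theorem nonempty_iso_iff (hi : 1 ≤ i) (hd : Odd d) (hG : Nat.card G = d)
    (hG' : Nat.card G' = d) :
    Nonempty (SkewBraceIso (HBrace i G) (HBrace i G')) ↔ Nonempty (G ≃+ G') := by
  have := ZMod.nontrivial_two_pow hi
  constructor
  · rintro ⟨E⟩
    obtain ⟨e, -⟩ := (isDihedralExtension i).exists_addEquiv (isDihedralExtension i)
      (coveredBy_negDouble_zmod_prod hd hG i) (coveredBy_negDouble_zmod_prod hd hG' i) E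
    exact nonempty_addEquiv_of_zmod_prod hd hG hG' e
  · rintro ⟨e⟩
    exact (isDihedralExtension i).nonempty_ringEquiv ((isDihedralExtension i).comap
      ((AddEquiv.refl _).prodCongr e) (prodCongr_negDouble _ e)
      (Prod.ext rfl (map_zero e)) (Prod.ext rfl (map_zero e)))

end HBrace

/-- The invariant `z` is zero on one side and `2^(i-1) ≠ 0` on the other. -/
theorem JBrace.isEmpty_iso_hBrace (hi : 1 ≤ i) (hd : Odd d) (hG : Nat.card G = d)
    (hG' : Nat.card G' = d) : IsEmpty (SkewBraceIso (JBrace i G) (HBrace i G')) := by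
  have := ZMod.nontrivial_two_pow hi
  refine ⟨fun E => ?_⟩
  obtain ⟨e, -, he⟩ := (JBrace.isDihedralExtension i).exists_addEquiv
    (HBrace.isDihedralExtension i) (coveredBy_negDouble_zmod_prod hd hG i)
    (coveredBy_negDouble_zmod_prod hd hG' i) E
  rw [map_zero] at he
  have h : ((2 ^ (i - 1) : ℕ) : ZMod (2 ^ i)) = 0 := by
    rw [Nat.cast_pow]
    exact (congrArg Prod.fst he).symm
  rw [ZMod.natCast_eq_zero_iff, Nat.pow_dvd_pow_iff_le_right one_lt_two] at h
  omega

namespace KBrace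

theorem nat_card (hG : Nat.card G = d) : Nat.card (KBrace G) = 2 ^ 3 * d := by
  rw [(isDihedralExtension (G := G)).nat_card, Nat.card_prod, Nat.card_prod, Nat.card_zmod, hG]
  ring

theorem hasExactlyOneVertex (hd : Odd d) (hG : Nat.card G = d) :
    (lambdaGraph (KBrace G)).HasExactlyOneVertex := by
  have : Finite G := Nat.finite_of_card_ne_zero (hG ▸ hd.pos.ne')
  exact isDihedralExtension.hasExactlyOneVertex (coveredBy_kleinHom hd hG)

theorem nonempty_iso_iff (hd : Odd d) (hG : Nat.card G = d) (hG' : Nat.card G' = d) :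
    Nonempty (SkewBraceIso (KBrace G) (KBrace G')) ↔ Nonempty (G ≃+ G') := by
  constructor
  · rintro ⟨E⟩
    obtain ⟨e, -⟩ := isDihedralExtension.exists_addEquiv isDihedralExtension
      (coveredBy_kleinHom hd hG) (coveredBy_kleinHom hd hG') E
    have : Finite G := Nat.finite_of_card_ne_zero (hG ▸ hd.pos.ne')
    refine nonempty_addEquiv_of_prod ?_ (hG.trans hG'.symm)
      ((AddEquiv.prodAssoc.trans e).trans AddEquiv.prodAssoc.symm)
    rw [Nat.card_prod, Nat.card_zmod, hG]
    have := Nat.coprime_two_left.2 hd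
    exact this.mul_left this
  · rintro ⟨e⟩
    exact isDihedralExtension.nonempty_ringEquiv (isDihedralExtension.comap
      ((AddEquiv.refl _).prodCongr ((AddEquiv.refl _).prodCongr e))
      (fun x => Prod.ext rfl (Prod.ext rfl
        ((map_neg e _).trans (congrArg Neg.neg (map_add e _ _)))))
      (Prod.ext rfl (Prod.ext rfl (map_zero e))) (Prod.ext rfl (Prod.ext rfl (map_zero e))))

/-- The element `(0, 1, 0)` is killed by doubling but not by `kleinHom`. -/
theorem not_exists_addEquiv_negDouble {F : Type*} [AddCommGroup F]
    (e : ZMod 2 × ZMod 2 × G ≃+ F) : ¬ ∀ x, e (kleinHom G x) = negDouble F (e x) := by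
  intro h
  have h1 := h (0, 1, 0)
  rw [negDouble_apply, ← map_add, ← map_neg] at h1
  have h2 := congrArg Prod.fst (e.injective h1)
  simp [kleinHom_apply] at h2

theorem isEmpty_iso_jBrace (hi : 1 ≤ i) (hd : Odd d) (hG : Nat.card G = d)
    (hG' : Nat.card G' = d) : IsEmpty (SkewBraceIso (KBrace G) (JBrace i G')) := by
  have := ZMod.nontrivial_two_pow hi
  refine ⟨fun E => ?_⟩
  obtain ⟨e, he, -⟩ := isDihedralExtension.exists_addEquiv (JBrace.isDihedralExtension i)
    (coveredBy_kleinHom hd hG) (coveredBy_negDouble_zmod_prod hd hG' i) E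
  exact not_exists_addEquiv_negDouble e he

theorem isEmpty_iso_hBrace (hi : 1 ≤ i) (hd : Odd d) (hG : Nat.card G = d)
    (hG' : Nat.card G' = d) : IsEmpty (SkewBraceIso (KBrace G) (HBrace i G')) := by
  have := ZMod.nontrivial_two_pow hi
  refine ⟨fun E => ?_⟩
  obtain ⟨e, he, -⟩ := isDihedralExtension.exists_addEquiv (HBrace.isDihedralExtension i)
    (coveredBy_kleinHom hd hG) (coveredBy_negDouble_zmod_prod hd hG' i) E
  exact not_exists_addEquiv_negDouble e he

end KBrace

/-! ### Counting isomorphism classes. -/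

/-- If the skew braces of size `n` with one-vertex `λ`-graph are, without repetitions, the members
of families indexed by `κ`, each parametrised by the abelian groups of order `d`, then their number
is `|κ| a(d)`. -/
theorem numOneVertexSkewBraces_eq {n d : ℕ} (κ : Type)
    (Φ : κ → AbelianGroupOfOrder.{u} d → OneVertexSkewBrace.{u} n)
    (hiso : ∀ j X Y, Nonempty (SkewBraceIso (Φ j X).carrier (Φ j Y).carrier) ↔
      Nonempty (X.carrier ≃+ Y.carrier))
    (hne : ∀ j k X Y, j ≠ k → IsEmpty (SkewBraceIso (Φ j X).carrier (Φ k Y).carrier))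
    (hsurj : ∀ B : OneVertexSkewBrace.{u} n, ∃ j X,
      Nonempty (SkewBraceIso B.carrier (Φ j X).carrier)) :
    numOneVertexSkewBraces.{u} n = Nat.card κ * numAbelianGroups.{u} d := by
  rw [numAbelianGroups, ← Nat.card_prod, numOneVertexSkewBraces]
  let f : κ × Quotient (AbelianGroupOfOrder.isoSetoid.{u} d) →
      Quotient (OneVertexSkewBrace.isoSetoid.{u} n) := fun p =>
    Quotient.lift (fun X => Quotient.mk (OneVertexSkewBrace.isoSetoid.{u} n) (Φ p.1 X))
      (fun X Y h => Quotient.sound ((hiso p.1 X Y).2 h)) p.2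
  refine (Nat.card_congr (Equiv.ofBijective f ⟨?_, ?_⟩)).symm
  · rintro ⟨j, X⟩ ⟨k, Y⟩
    induction X using Quotient.inductionOn with | _ X
    induction Y using Quotient.inductionOn with | _ Y
    intro h
    obtain ⟨E⟩ : Nonempty (SkewBraceIso (Φ j X).carrier (Φ k Y).carrier) := Quotient.exact h
    obtain rfl : j = k := by
      by_contra hjk
      exact (hne j k X Y hjk).false E
    exact Prod.ext rfl (Quotient.sound ((hiso j X Y).1 ⟨E⟩))
  · intro B
    induction B using Quotient.inductionOn with | _ B
    obtain ⟨j, X, h⟩ := hsurj B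
    exact ⟨(j, Quotient.mk _ X), (Quotient.sound h).symm⟩

namespace AbelianGroupOfOrder

/-- The skew brace `D_{2d}(G)`. -/
def dBrace (hd : Odd d) (h1 : d ≠ 1) (X : AbelianGroupOfOrder.{u} d) :
    OneVertexSkewBrace.{u} (2 ^ 1 * d) where
  carrier := DBrace X.carrier
  finite := Nat.finite_of_card_ne_zero (by
    rw [DBrace.nat_card X.card_eq]; exact mul_ne_zero (by simp) hd.pos.ne')
  card_eq := DBrace.nat_card X.card_eq
  oneVertex := DBrace.hasExactlyOneVertex hd X.card_eq h1

/-- The skew brace `J_{2^(i+1)d}(G)`. -/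
def jBrace (hi : 1 ≤ i) (hd : Odd d) (X : AbelianGroupOfOrder.{u} d) :
    OneVertexSkewBrace.{u} (2 ^ (i + 1) * d) where
  carrier := JBrace i X.carrier
  finite := Nat.finite_of_card_ne_zero (by
    rw [JBrace.nat_card i X.card_eq]; exact mul_ne_zero (by simp) hd.pos.ne')
  card_eq := JBrace.nat_card i X.card_eq
  oneVertex := JBrace.hasExactlyOneVertex hi hd X.card_eq

/-- The skew brace `H_{2^(i+1)d}(G)`. -/
def hBrace (hi : 1 ≤ i) (hd : Odd d) (X : AbelianGroupOfOrder.{u} d) :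
    OneVertexSkewBrace.{u} (2 ^ (i + 1) * d) where
  carrier := HBrace i X.carrier
  finite := Nat.finite_of_card_ne_zero (by
    rw [HBrace.nat_card i X.card_eq]; exact mul_ne_zero (by simp) hd.pos.ne')
  card_eq := HBrace.nat_card i X.card_eq
  oneVertex := HBrace.hasExactlyOneVertex hi hd X.card_eq

/-- The skew brace `K_{8d}(G)`. -/
def kBrace (hd : Odd d) (X : AbelianGroupOfOrder.{u} d) :
    OneVertexSkewBrace.{u} (2 ^ (2 + 1) * d) where
  carrier := KBrace X.carrier
  finite := Nat.finite_of_card_ne_zero (by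
    rw [KBrace.nat_card X.card_eq]; exact mul_ne_zero (by simp) hd.pos.ne')
  card_eq := KBrace.nat_card X.card_eq
  oneVertex := KBrace.hasExactlyOneVertex hd X.card_eq

end AbelianGroupOfOrder

open AbelianGroupOfOrder

theorem numOneVertexSkewBraces_of_odd (hd : Odd d) : numOneVertexSkewBraces.{u} d = 0 := by
  have : IsEmpty (Quotient (OneVertexSkewBrace.isoSetoid.{u} d)) := by
    refine ⟨fun B => ?_⟩
    induction B using Quotient.inductionOn with | _ B
    exact (SkewBrace.exists_iso_of_hasExactlyOneVertex (m := 0) hd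
      (by rw [B.card_eq, pow_zero, one_mul]) B.oneVertex).1 rfl
  exact Nat.card_of_isEmpty

theorem numOneVertexSkewBraces_two : numOneVertexSkewBraces.{u} (2 ^ 1 * 1) = 0 := by
  have : IsEmpty (Quotient (OneVertexSkewBrace.isoSetoid.{u} (2 ^ 1 * 1))) := by
    refine ⟨fun B => ?_⟩
    induction B using Quotient.inductionOn with | _ B
    obtain ⟨-, G, _, hG, ⟨-, h, -⟩ | ⟨h, -⟩ | ⟨h, -⟩ | ⟨h, -⟩⟩ :=
      SkewBrace.exists_iso_of_hasExactlyOneVertex odd_one B.card_eq B.oneVertex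
    · exact h rfl
    all_goals omega
  exact Nat.card_of_isEmpty

theorem numOneVertexSkewBraces_two_mul (hd : Odd d) (h1 : d ≠ 1) :
    numOneVertexSkewBraces.{u} (2 ^ 1 * d) = numAbelianGroups.{u} d := by
  rw [numOneVertexSkewBraces_eq Unit (fun _ => dBrace hd h1)
    (fun _ X Y => DBrace.nonempty_iso_iff hd X.card_eq Y.card_eq)
    (fun _ _ _ _ h => (h rfl).elim), Nat.card_unique, one_mul]
  intro B
  obtain ⟨-, G, _, hG, ⟨-, -, h⟩ | ⟨h, -⟩ | ⟨h, -⟩ | ⟨h, -⟩⟩ :=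
    SkewBrace.exists_iso_of_hasExactlyOneVertex hd B.card_eq B.oneVertex
  · exact ⟨(), ⟨G, hG⟩, h⟩
  all_goals omega

theorem numOneVertexSkewBraces_two_pow_mul (hi : 1 ≤ i) (hi2 : i ≠ 2) (hd : Odd d) :
    numOneVertexSkewBraces.{u} (2 ^ (i + 1) * d) = 2 * numAbelianGroups.{u} d := by
  rw [numOneVertexSkewBraces_eq (Fin 2) ![jBrace hi hd, hBrace hi hd] ?_ ?_ ?_, Nat.card_fin]
  · intro j X Y
    fin_cases j
    · exact JBrace.nonempty_iso_iff hi hd X.card_eq Y.card_eq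
    · exact HBrace.nonempty_iso_iff hi hd X.card_eq Y.card_eq
  · intro j k X Y hjk
    have h := fun X Y : AbelianGroupOfOrder.{u} d =>
      JBrace.isEmpty_iso_hBrace hi hd X.card_eq Y.card_eq
    fin_cases j <;> fin_cases k
    · exact (hjk rfl).elim
    · exact h X Y
    · exact ⟨fun E => (h Y X).false E.symm⟩
    · exact (hjk rfl).elim
  · intro B
    obtain ⟨-, G, _, hG, ⟨h, -⟩ | ⟨-, h⟩ | ⟨-, h⟩ | ⟨h, -⟩⟩ :=
      SkewBrace.exists_iso_of_hasExactlyOneVertex hd B.card_eq B.oneVertex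
    · omega
    · exact ⟨0, ⟨G, hG⟩, h⟩
    · exact ⟨1, ⟨G, hG⟩, h⟩
    · omega

theorem numOneVertexSkewBraces_eight_mul (hd : Odd d) :
    numOneVertexSkewBraces.{u} (2 ^ (2 + 1) * d) = 3 * numAbelianGroups.{u} d := by
  have hi : 1 ≤ 2 := one_le_two
  rw [numOneVertexSkewBraces_eq (Fin 3) ![kBrace hd, jBrace hi hd, hBrace hi hd] ?_ ?_ ?_,
    Nat.card_fin]
  · intro j X Y
    fin_cases j
    · exact KBrace.nonempty_iso_iff hd X.card_eq Y.card_eq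
    · exact JBrace.nonempty_iso_iff hi hd X.card_eq Y.card_eq
    · exact HBrace.nonempty_iso_iff hi hd X.card_eq Y.card_eq
  · intro j k X Y hjk
    have h := fun X Y : AbelianGroupOfOrder.{u} d =>
      JBrace.isEmpty_iso_hBrace hi hd X.card_eq Y.card_eq
    have hJ := fun X Y : AbelianGroupOfOrder.{u} d =>
      KBrace.isEmpty_iso_jBrace hi hd X.card_eq Y.card_eq
    have hH := fun X Y : AbelianGroupOfOrder.{u} d =>
      KBrace.isEmpty_iso_hBrace hi hd X.card_eq Y.card_eq
    fin_cases j <;> fin_cases k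
    · exact (hjk rfl).elim
    · exact hJ X Y
    · exact hH X Y
    · exact ⟨fun E => (hJ Y X).false E.symm⟩
    · exact (hjk rfl).elim
    · exact h X Y
    · exact ⟨fun E => (hH Y X).false E.symm⟩
    · exact ⟨fun E => (h Y X).false E.symm⟩
    · exact (hjk rfl).elim
  · intro B
    obtain ⟨-, G, _, hG, ⟨h, -⟩ | ⟨-, h⟩ | ⟨-, h⟩ | ⟨-, h⟩⟩ :=
      SkewBrace.exists_iso_of_hasExactlyOneVertex hd B.card_eq B.oneVertex
    · omega
    · exact ⟨1, ⟨G, hG⟩, h⟩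
    · exact ⟨2, ⟨G, hG⟩, h⟩
    · exact ⟨0, ⟨G, hG⟩, h⟩

end Classification

theorem mainTheorem1 (m d : ℕ) (hd : Odd d) :
    -- the listed skew braces have size `2 ^ m * d` and one-vertex `λ`-graph
    (∀ (G : Type u) [AddCommGroup G], Nat.card G = d →
      (m = 1 → d ≠ 1 →
        Nat.card (DBrace G) = 2 ^ m * d ∧ (lambdaGraph (DBrace G)).HasExactlyOneVertex) ∧
      (2 ≤ m →
        Nat.card (JBrace (m - 1) G) = 2 ^ m * d ∧
          (lambdaGraph (JBrace (m - 1) G)).HasExactlyOneVertex) ∧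
      (2 ≤ m →
        Nat.card (HBrace (m - 1) G) = 2 ^ m * d ∧
          (lambdaGraph (HBrace (m - 1) G)).HasExactlyOneVertex) ∧
      (m = 3 →
        Nat.card (KBrace G) = 2 ^ m * d ∧ (lambdaGraph (KBrace G)).HasExactlyOneVertex)) ∧
    -- the list is complete
    (∀ (A : Type u) [SkewBrace A] [Finite A], Nat.card A = 2 ^ m * d →
      (lambdaGraph A).HasExactlyOneVertex →
      m ≠ 0 ∧
      ∃ (G : Type u) (_ : AddCommGroup G), Nat.card G = d ∧
        ((m = 1 ∧ d ≠ 1 ∧ Nonempty (SkewBraceIso A (DBrace G))) ∨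
          (2 ≤ m ∧ Nonempty (SkewBraceIso A (JBrace (m - 1) G))) ∨
          (2 ≤ m ∧ Nonempty (SkewBraceIso A (HBrace (m - 1) G))) ∨
          (m = 3 ∧ Nonempty (SkewBraceIso A (KBrace G))))) ∧
    -- the list has no repetitions up to isomorphism
    (∀ (G G' : Type u) [AddCommGroup G] [AddCommGroup G'], Nat.card G = d → Nat.card G' = d →
      (m = 1 → (Nonempty (SkewBraceIso (DBrace G) (DBrace G')) ↔ Nonempty (G ≃+ G'))) ∧
      (2 ≤ m →
        (Nonempty (SkewBraceIso (JBrace (m - 1) G) (JBrace (m - 1) G')) ↔ Nonempty (G ≃+ G')) ∧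
        (Nonempty (SkewBraceIso (HBrace (m - 1) G) (HBrace (m - 1) G')) ↔ Nonempty (G ≃+ G')) ∧
        IsEmpty (SkewBraceIso (JBrace (m - 1) G) (HBrace (m - 1) G'))) ∧
      (m = 3 →
        (Nonempty (SkewBraceIso (KBrace G) (KBrace G')) ↔ Nonempty (G ≃+ G')) ∧
        IsEmpty (SkewBraceIso (KBrace G) (JBrace (m - 1) G')) ∧
        IsEmpty (SkewBraceIso (KBrace G) (HBrace (m - 1) G')))) ∧
    -- the number of isomorphism classes
    (m = 0 → numOneVertexSkewBraces.{u} (2 ^ m * d) = 0) ∧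
    (m = 1 → d = 1 → numOneVertexSkewBraces.{u} (2 ^ m * d) = 0) ∧
    (m = 1 → d ≠ 1 → numOneVertexSkewBraces.{u} (2 ^ m * d) = numAbelianGroups.{u} d) ∧
    (m = 2 → numOneVertexSkewBraces.{u} (2 ^ m * d) = 2 * numAbelianGroups.{u} d) ∧
    (m = 3 → numOneVertexSkewBraces.{u} (2 ^ m * d) = 3 * numAbelianGroups.{u} d) ∧
    (4 ≤ m → numOneVertexSkewBraces.{u} (2 ^ m * d) = 2 * numAbelianGroups.{u} d) := by
  refine ⟨fun G _ hG => ⟨?_, ?_, ?_, ?_⟩, fun A _ _ hcard hA =>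
    SkewBrace.exists_iso_of_hasExactlyOneVertex hd hcard hA,
    fun G G' _ _ hG hG' => ⟨?_, ?_, ?_⟩, ?_, ?_, ?_, ?_, ?_, ?_⟩
  · rintro rfl h1
    exact ⟨DBrace.nat_card hG, DBrace.hasExactlyOneVertex hd hG h1⟩
  · intro hm
    obtain ⟨i, rfl⟩ := Nat.exists_eq_add_of_le' (one_le_two.trans hm)
    exact ⟨JBrace.nat_card i hG, JBrace.hasExactlyOneVertex (Nat.le_of_succ_le_succ hm) hd hG⟩
  · intro hm
    obtain ⟨i, rfl⟩ := Nat.exists_eq_add_of_le' (one_le_two.trans hm)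
    exact ⟨HBrace.nat_card i hG, HBrace.hasExactlyOneVertex (Nat.le_of_succ_le_succ hm) hd hG⟩
  · rintro rfl
    exact ⟨KBrace.nat_card hG, KBrace.hasExactlyOneVertex hd hG⟩
  · rintro -
    exact DBrace.nonempty_iso_iff hd hG hG'
  · intro hm
    have hi : 1 ≤ m - 1 := by omega
    exact ⟨JBrace.nonempty_iso_iff hi hd hG hG', HBrace.nonempty_iso_iff hi hd hG hG',
      JBrace.isEmpty_iso_hBrace hi hd hG hG'⟩
  · rintro rfl
    exact ⟨KBrace.nonempty_iso_iff hd hG hG', KBrace.isEmpty_iso_jBrace one_le_two hd hG hG',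
      KBrace.isEmpty_iso_hBrace one_le_two hd hG hG'⟩
  · rintro rfl
    rw [pow_zero, one_mul]
    exact numOneVertexSkewBraces_of_odd hd
  · rintro rfl rfl
    exact numOneVertexSkewBraces_two
  · rintro rfl h1
    exact numOneVertexSkewBraces_two_mul hd h1
  · rintro rfl
    exact numOneVertexSkewBraces_two_pow_mul le_rfl (by omega) hd
  · rintro rfl
    exact numOneVertexSkewBraces_eight_mul hd
  · intro hm
    obtain ⟨i, rfl⟩ := Nat.exists_eq_add_of_le' (show 1 ≤ m by omega)
    exact numOneVertexSkewBraces_two_pow_mul (by omega) (by omega) hd
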